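/- All graphs are finite, simple and undirected. A cutset of a graph $G$ is a set $S$ of vertices such that $G-S$ is disconnected (has at least two connected components); an independent cutset is a cutset whose vertices are pairwise nonadjacent. Running times are measured on a random access machine with unit-cost instructions whose registers and arrays hold natural numbers and whose only arithmetic operations are $\pm 1$. The input graph is given by its number $n$ of vertices and its adjacency matrix, vertex sets are given by characteristic vectors, and $T(n)=\mathcal{O}^*(f(n))$ means $T(n)=\mathcal{O}(n^k f(n))$ for some constant $k$. 1. There is an algorithm that, given a connected graph $G$ with $n$ vertices that admits an independent cutset, finds an independent cutset of $G$ of minimum cardinality in $\mathcal{O}^*(3^{n/3})$ time. 2. There is an algorithm that, given a connected graph $G$ with $n$ vertices and an independent cutset $S'$ of $G$, computes in time polynomial in $n$ an independent cutset $S\subseteq S'$ of $G$ that has minimum cardinality among all independent cutsets of $G$ contained in $S'$. 3. Let $G$ be a connected graph and $S'$ an independent cutset of $G$. Let $H$ be the hypergraph whose vertices are the connected components of $G-S'$ and which has, for every $v\in S'$, one hyperedge $e_v=\{K : K \text{ is a component of } G-S' \text{ containing a neighbor of } v\}$ (equal hyperedges count with multiplicity). An edge cut of $H$ is the set of all hyperedges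 that meet both parts of a partition of the vertex set of $H$ into two nonempty parts. Then, for every $F\subseteq S'$, the set $\{e_v : v\in F\}$ is an edge cut of $H$ of minimum cardinality if and only if $F$ is an independent cutset of $G$ that has minimum cardinality among all independent cutsets of $G$ contained in $S'$. -/

import Mathlib

open Filter Asymptotics

/-! ### Cutsets of a graph -/

namespace SimpleGraph

variable {V : Type*}

/-- `S` is a cutset of `G` if `G - S` is disconnected, i.e. has two vertices in different components.
(The graph without vertices is not disconnected.) -/
def IsCutset (G : SimpleGraph V) (S : Finset V) : Prop :=
  ¬ (G.induce ((S : Set V)ᶜ)).Preconnected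

/-- An independent cutset is a cutset whose vertices are pairwise nonadjacent. -/
def IsIndepCutset (G : SimpleGraph V) (S : Finset V) : Prop :=
  G.IsIndepSet (S : Set V) ∧ G.IsCutset S

/-- `S` is an independent cutset of `G` of minimum cardinality. -/
def IsMinimumIndepCutset (G : SimpleGraph V) (S : Finset V) : Prop :=
  G.IsIndepCutset S ∧ ∀ T : Finset V, G.IsIndepCutset T → S.card ≤ T.card

/-- `S` is an independent cutset of `G` that has minimum cardinality among those contained
in `S'`. -/
def IsSmallestIndepCutsetIn (G : SimpleGraph V) (S' S : Finset V) : Prop :=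
  S ⊆ S' ∧ G.IsIndepCutset S ∧ ∀ T ⊆ S', G.IsIndepCutset T → S.card ≤ T.card

end SimpleGraph

/-! ### Hypergraphs and their edge cuts -/

/-- A hypergraph with vertex set `α` and a family of hyperedges indexed by `ι` (parallel hyperedges
are allowed and count with multiplicity). -/
structure MultiHypergraph (α ι : Type*) where
  edge : ι → Set α

namespace MultiHypergraph

variable {α ι : Type*}

/-- `F` is an edge cut of `H`: the set of all hyperedges that meet both sides of a partition of the
vertex set into two nonempty parts `X` and `Xᶜ`. -/
def IsEdgeCut (H : MultiHypergraph α ι) (F : Finset ι) : Prop :=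
  ∃ X : Set α, X.Nonempty ∧ Xᶜ.Nonempty ∧
    ∀ e, e ∈ F ↔ (H.edge e ∩ X).Nonempty ∧ (H.edge e ∩ Xᶜ).Nonempty

/-- `F` is an edge cut of `H` with the least number of hyperedges. -/
def IsMinimumEdgeCut (H : MultiHypergraph α ι) (F : Finset ι) : Prop :=
  H.IsEdgeCut F ∧ ∀ F' : Finset ι, H.IsEdgeCut F' → F.card ≤ F'.card

end MultiHypergraph

/-- The auxiliary hypergraph of `G` and `S'`: its vertices are the components of `G - S'`, and each
vertex `v` of `S'` gives the hyperedge of all components that contain a neighbor of `v`. -/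
def SimpleGraph.cutHypergraph {V : Type*} (G : SimpleGraph V) (S' : Finset V) :
    MultiHypergraph (G.induce ((S' : Set V)ᶜ)).ConnectedComponent {v // v ∈ S'} where
  edge v := {K | ∃ w ∈ K.supp, G.Adj v.1 w.1}

/-! ### Random access machines with a step count

A program uses finitely many registers and finitely many one-dimensional arrays, all of which hold
natural numbers. The only arithmetic is adding or subtracting one, so that after `t` steps no
number exceeds the largest initial number or program constant by more than `t`; hence every
elementary instruction can be charged one step. -/

namespace RAM

/-- The contents of all registers and of all arrays. -/
structure State where
  reg : ℕ → ℕ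
  arr : ℕ → ℕ → ℕ

/-- Elementary instructions. -/
inductive Instr where
  /-- `reg r := c` -/
  | const (r c : ℕ)
  /-- `reg r := reg s` -/
  | copy (r s : ℕ)
  /-- `reg r := reg r + 1` -/
  | succ (r : ℕ)
  /-- `reg r := reg r - 1` (and `0` stays `0`) -/
  | pred (r : ℕ)
  /-- `reg r := arr a [reg s]` -/
  | load (r a s : ℕ)
  /-- `arr a [reg s] := reg r` -/
  | store (a s r : ℕ)

/-- The effect of an elementary instruction. -/
def Instr.apply : Instr → State → State
  | .const r c, σ => { σ with reg := Function.update σ.reg r c }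
  | .copy r s, σ => { σ with reg := Function.update σ.reg r (σ.reg s) }
  | .succ r, σ => { σ with reg := Function.update σ.reg r (σ.reg r + 1) }
  | .pred r, σ => { σ with reg := Function.update σ.reg r (σ.reg r - 1) }
  | .load r a s, σ => { σ with reg := Function.update σ.reg r (σ.arr a (σ.reg s)) }
  | .store a s r, σ =>
      let row := Function.update (σ.arr a) (σ.reg s) (σ.reg r)
      { σ with arr := Function.update σ.arr a row }

/-- Elementary tests. -/
inductive Test where
  /-- `reg r ≠ 0` -/
  | nonzero (r : ℕ)
  /-- `reg r = reg s` -/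
  | eq (r s : ℕ)
  /-- `reg r < reg s` -/
  | lt (r s : ℕ)

/-- The test succeeds in the given state. -/
def Test.Holds : Test → State → Prop
  | .nonzero r, σ => σ.reg r ≠ 0
  | .eq r s, σ => σ.reg r = σ.reg s
  | .lt r s, σ => σ.reg r < σ.reg s

/-- Programs: elementary instructions, sequential composition, branching and while loops. -/
inductive Program where
  | skip
  | instr (i : Instr)
  | seq (p q : Program)
  | cond (b : Test) (p q : Program)
  | loop (b : Test) (p : Program)

/-- `Exec p σ t σ'`: started in state `σ`, the program `p` halts after exactly `t` steps in state
`σ'`. Every instruction and every evaluation of a test takes one step. The rules are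
deterministic. -/
inductive Exec : Program → State → ℕ → State → Prop
  | skip (σ : State) : Exec .skip σ 1 σ
  | instr (i : Instr) (σ : State) : Exec (.instr i) σ 1 (i.apply σ)
  | seq {p q : Program} {σ₁ σ₂ σ₃ : State} {s t : ℕ} :
      Exec p σ₁ s σ₂ → Exec q σ₂ t σ₃ → Exec (.seq p q) σ₁ (s + t) σ₃
  | condTrue {b : Test} {p q : Program} {σ σ' : State} {t : ℕ} :
      b.Holds σ → Exec p σ t σ' → Exec (.cond b p q) σ (1 + t) σ'
  | condFalse {b : Test} {p q : Program} {σ σ' : State} {t : ℕ} :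
      ¬ b.Holds σ → Exec q σ t σ' → Exec (.cond b p q) σ (1 + t) σ'
  | loopTrue {b : Test} {p : Program} {σ₁ σ₂ σ₃ : State} {s t : ℕ} :
      b.Holds σ₁ → Exec p σ₁ s σ₂ → Exec (.loop b p) σ₂ t σ₃ →
        Exec (.loop b p) σ₁ (1 + s + t) σ₃
  | loopFalse {b : Test} {p : Program} {σ : State} :
      ¬ b.Holds σ → Exec (.loop b p) σ 1 σ

/-- Started in `σ`, the program `p` halts after at most `T` steps in a state satisfying `Q`. -/
def HaltsWithin (p : Program) (σ : State) (T : ℕ) (Q : State → Prop) : Prop :=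
  ∃ t ≤ T, ∃ σ', Exec p σ t σ' ∧ Q σ'

open Classical in
/-- The adjacency matrix of `G`, row by row, as the contents of an array. -/
noncomputable def graphArray {n : ℕ} (G : SimpleGraph (Fin n)) : ℕ → ℕ := fun x =>
  if ∃ i j : Fin n, G.Adj i j ∧ x = i.val * n + j.val then 1 else 0

/-- The characteristic vector of `S` as the contents of an array. -/
def setArray {n : ℕ} (S : Finset (Fin n)) : ℕ → ℕ := fun x =>
  if ∃ i ∈ S, x = i.val then 1 else 0

/-- The initial state for an input that consists of a graph `G` on `n` vertices: register `0` holds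
`n`, array `0` holds the adjacency matrix, and everything else is `0`. -/
noncomputable def graphInput {n : ℕ} (G : SimpleGraph (Fin n)) : State where
  reg := Function.update (fun _ => 0) 0 n
  arr := Function.update (fun _ _ => 0) 0 (graphArray G)

/-- The initial state for an input that consists of a graph `G` and a vertex set `S`: as for `G`
alone, but array `1` holds the characteristic vector of `S`. -/
noncomputable def graphSetInput {n : ℕ} (G : SimpleGraph (Fin n)) (S : Finset (Fin n)) :
    State where
  reg := (graphInput G).reg
  arr := Function.update (graphInput G).arr 1 (setArray S)

/-- The output of a final state is `S`: the first `n` entries of array `2` are the characteristic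
vector of `S`. -/
def Outputs {n : ℕ} (σ : State) (S : Finset (Fin n)) : Prop :=
  ∀ i : Fin n, σ.arr 2 i.val = if i ∈ S then 1 else 0

end RAM

/-- `T(n) = O*(f(n))`: up to a polynomial factor, `T(n) = O(f(n))`. -/
def IsOStar (T : ℕ → ℕ) (f : ℕ → ℝ) : Prop :=
  ∃ k : ℕ, (fun n => (T n : ℝ)) =O[atTop] fun n => (n : ℝ) ^ k * f n

/-! ### Programs whose only loops run over `0, …, n - 1`

Such a block always halts within a number of steps that is polynomial in the content `n` of
register `0`, so that only its effect has to be studied. -/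

namespace RAM

/-! Fix an independent set `T`. Give every vertex `v` the hyperedge formed by the vertices of its
closed neighborhood outside of `T`, with weight `1` if `v ∈ T` and weight `n` otherwise. A partition
of the complement of `T` of weight below `n` separates no vertex outside of `T`, so it is a
partition of the components of `G - T`, and the vertices that it separates form an independent
cutset whose size is the weight (`cutFinset_spec`). Conversely, if `G` is connected, every cutset `S
⊆ T` yields a partition that separates only vertices of `S` (`exists_cutWeight_le`). A smallest
cutset inside `T` is therefore a minimum hypergraph cut, and components never have to be computed.
The same correspondence, stated for components instead of vertices, gives the claim on the auxiliary
hypergraph (`isMinimumEdgeCut_iff`).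

Minimum hypergraph cuts are found by maximum adjacency orderings, as in the algorithm of Stoer and
Wagner. If `prev` and `last` are the final two vertices of such an ordering, isolating `last` is a
cheapest way to separate them (`Follows.links_le`, `Follows.insert`). So this cut is recorded and
the two classes are merged (`wp_phase`); after at most `n` phases one class is left (`wp_minCut`).
This settles the search inside a given cutset.

For the global minimum, every independent cutset lies in a maximal independent set, and the cut
algorithm is run on each of these. They are enumerated by branching on an alive vertex whose closed
alive neighborhood has least size `s`: some member of this neighborhood must be added, and each
choice removes at least `s` alive vertices. Since `s ≤ 3^(s/3)`, a potential of order `m * 3^(m/3)`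
in the number `m` of alive vertices drops by at least one in every step
(`totalPotential_children_le`).

The programs are built from blocks with counting loops only, for which termination in polynomial
time is automatic (`exec_compile`) and correctness is shown with weakest preconditions. The single
while loop works off a queue of independent sets, and the potential bounds its number of passes
(`haltsWithin_loop`). -/

/-- `σ` with register `r` set to `x`. -/
def State.setReg (σ : State) (r x : ℕ) : State :=
  { σ with reg := Function.update σ.reg r x }

/-- `σ` with entry `i` of array `a` set to `x`. -/
def State.setArr (σ : State) (a i x : ℕ) : State :=
  { σ with arr := Function.update σ.arr a (Function.update (σ.arr a) i x) }

@[simp] theorem State.setReg_reg (σ : State) (r x s : ℕ) :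
    (σ.setReg r x).reg s = if s = r then x else σ.reg s := by
  simp [State.setReg, Function.update_apply]

@[simp] theorem State.setReg_arr (σ : State) (r x : ℕ) : (σ.setReg r x).arr = σ.arr := rfl

@[simp] theorem State.setArr_reg (σ : State) (a i x : ℕ) : (σ.setArr a i x).reg = σ.reg := rfl

@[simp] theorem State.setArr_arr (σ : State) (a i x b : ℕ) :
    (σ.setArr a i x).arr b = if b = a then Function.update (σ.arr a) i x else σ.arr b := by
  simp [State.setArr, Function.update_apply]

/-- Programs whose only loops are of the form `for i = 0, …, n - 1`, where `n` is the content of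
register `0`. -/
inductive Block where
  | skip
  | instr (i : Instr)
  | seq (p q : Block)
  | cond (b : Test) (p q : Block)
  | forN (i : ℕ) (p : Block)

/-- Sequential composition of blocks. -/
infixr:60 " ⨾ " => Block.seq

namespace Block

/-- The block as a program. -/
def compile : Block → Program
  | skip => .skip
  | instr i => .instr i
  | seq p q => .seq p.compile q.compile
  | cond b p q => .cond b p.compile q.compile
  | forN i p => .seq (.instr (.const i 0))
      (.loop (.lt i 0) (.seq p.compile (.instr (.succ i))))

open Classical in
/-- The effect of a block. -/
noncomputable def run : Block → State → State
  | skip, σ => σ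
  | instr i, σ => i.apply σ
  | seq p q, σ => q.run (p.run σ)
  | cond b p q, σ => if b.Holds σ then p.run σ else q.run σ
  | forN i p, σ => (fun τ => (p.run τ).setReg i (τ.reg i + 1))^[σ.reg 0] (σ.setReg i 0)

/-- The block never writes to register `r`. -/
def keeps : Block → ℕ → Bool
  | skip, _ => true
  | instr (.const s _), r => r != s
  | instr (.copy s _), r => r != s
  | instr (.succ s), r => r != s
  | instr (.pred s), r => r != s
  | instr (.load s _ _), r => r != s
  | instr (.store _ _ _), _ => true
  | seq p q, r => p.keeps r && q.keeps r
  | cond _ p q, r => p.keeps r && q.keeps r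
  | forN i p, r => r != i && p.keeps r

/-- The block never writes to array `a`. -/
def keepsArr : Block → ℕ → Bool
  | instr (.store b _ _), a => a != b
  | seq p q, a => p.keepsArr a && q.keepsArr a
  | cond _ p q, a => p.keepsArr a && q.keepsArr a
  | forN _ p, a => p.keepsArr a
  | _, _ => true

/-- The bodies of the loops of a block change neither the bound nor the counter. -/
def wf : Block → Bool
  | seq p q => p.wf && q.wf
  | cond _ p q => p.wf && q.wf
  | forN i p => i != 0 && p.keeps 0 && p.keeps i && p.wf
  | _ => true

/-- A bound for the running time of a block. -/
noncomputable def cost : Block → Polynomial ℕ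
  | skip => 1
  | instr _ => 1
  | seq p q => p.cost + q.cost
  | cond _ p q => 1 + p.cost + q.cost
  | forN _ p => 2 + Polynomial.X * (p.cost + 2)

/-- `τ` agrees with `σ` wherever `p` does not write. -/
structure Frame (p : Block) (σ τ : State) : Prop where
  reg : ∀ r, p.keeps r = true → τ.reg r = σ.reg r
  arr : ∀ a, p.keepsArr a = true → τ.arr a = σ.arr a

theorem frame_iterate {i : ℕ} {p : Block} (hp : ∀ σ, Frame p σ (p.run σ)) (m : ℕ) (σ : State) :
    Frame (forN i p) σ
      ((fun τ => (p.run τ).setReg i (τ.reg i + 1))^[m] (σ.setReg i 0)) := by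
  induction m with
  | zero =>
    refine ⟨fun r hr => ?_, fun a ha => rfl⟩
    simp [keeps] at hr
    simp [hr.1]
  | succ m ih =>
    rw [Function.iterate_succ_apply']
    refine ⟨fun r hr => ?_, fun a ha => ?_⟩
    · have hr' := hr
      simp [keeps] at hr'
      rw [State.setReg_reg, if_neg hr'.1, (hp _).reg r hr'.2, ih.reg r hr]
    · rw [State.setReg_arr, (hp _).arr a ha, ih.arr a ha]

theorem frame_run (p : Block) (σ : State) : Frame p σ (p.run σ) := by
  induction p generalizing σ with
  | skip => exact ⟨fun _ _ => rfl, fun _ _ => rfl⟩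
  | instr i =>
    constructor
    · intro r hr
      cases i <;> simp_all [keeps, run, Instr.apply]
    · intro a ha
      cases i <;> simp_all [keepsArr, run, Instr.apply]
  | seq p q hp hq =>
    constructor
    · intro r hr
      simp only [keeps, Bool.and_eq_true] at hr
      rw [run, (hq _).reg r hr.2, (hp _).reg r hr.1]
    · intro r hr
      simp only [keepsArr, Bool.and_eq_true] at hr
      rw [run, (hq _).arr r hr.2, (hp _).arr r hr.1]
  | cond b p q hp hq =>
    constructor
    · intro r hr
      simp only [keeps, Bool.and_eq_true] at hr
      rw [run]
      split_ifs
      exacts [(hp _).reg r hr.1, (hq _).reg r hr.2]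
    · intro r hr
      simp only [keepsArr, Bool.and_eq_true] at hr
      rw [run]
      split_ifs
      exacts [(hp _).arr r hr.1, (hq _).arr r hr.2]
  | forN i p hp => exact frame_iterate hp _ σ

theorem iterate_reg {i : ℕ} {p : Block} (hp : p.keeps i = true) (m : ℕ) (σ : State) :
    ((fun τ => (p.run τ).setReg i (τ.reg i + 1))^[m] (σ.setReg i 0)).reg i = m := by
  cases m with
  | zero => simp
  | succ m =>
    rw [Function.iterate_succ_apply', State.setReg_reg, if_pos rfl]
    congr 1
    exact iterate_reg hp m σ

/-- A block halts in polynomial time. -/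
theorem exec_compile (p : Block) (h0 : p.keeps 0 = true) (hp : p.wf = true) (σ : State) :
    ∃ t ≤ p.cost.eval (σ.reg 0), Exec p.compile σ t (p.run σ) := by
  induction p generalizing σ with
  | skip => exact ⟨1, by simp [cost], .skip σ⟩
  | instr i => exact ⟨1, by simp [cost], .instr i σ⟩
  | seq p q ihp ihq =>
    simp only [keeps, wf, Bool.and_eq_true] at h0 hp
    obtain ⟨s, hs, es⟩ := ihp h0.1 hp.1 σ
    obtain ⟨t, ht, et⟩ := ihq h0.2 hp.2 (p.run σ)
    rw [(frame_run p σ).reg 0 h0.1] at ht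
    exact ⟨s + t, by simpa [cost] using add_le_add hs ht, .seq es et⟩
  | cond b p q ihp ihq =>
    simp only [keeps, wf, Bool.and_eq_true] at h0 hp
    by_cases hb : b.Holds σ
    · obtain ⟨s, hs, es⟩ := ihp h0.1 hp.1 σ
      refine ⟨1 + s, ?_, ?_⟩
      · simp [cost]; omega
      · rw [run, if_pos hb]; exact .condTrue hb es
    · obtain ⟨s, hs, es⟩ := ihq h0.2 hp.2 σ
      refine ⟨1 + s, ?_, ?_⟩
      · simp [cost]; omega
      · rw [run, if_neg hb]; exact .condFalse hb es
  | forN i p ih =>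
    have h0' := h0
    simp only [keeps, wf, Bool.and_eq_true, bne_iff_ne] at h0 hp
    obtain ⟨⟨⟨hi, -⟩, hpi⟩, hpw⟩ := hp
    set n := σ.reg 0 with hn
    set f : State → State := fun τ => (p.run τ).setReg i (τ.reg i + 1) with hf
    have hreg : ∀ k, (f^[k] (σ.setReg i 0)).reg i = k := fun k => iterate_reg hpi k σ
    have hreg0 : ∀ k, (f^[k] (σ.setReg i 0)).reg 0 = n := fun k =>
      (frame_iterate (frame_run p) k σ).reg 0 h0'
    -- Induction on the number `m` of passes still to come. A pass costs the body plus two steps,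
    -- for the test and for the increment of the counter.
    have key : ∀ m k, m + k = n → ∃ t ≤ 1 + m * (p.cost.eval n + 2),
        Exec (.loop (.lt i 0) (.seq p.compile (.instr (.succ i)))) (f^[k] (σ.setReg i 0)) t
          (f^[n] (σ.setReg i 0)) := by
      intro m
      induction m with
      | zero =>
        intro k hk
        rw [show k = n by omega]
        exact ⟨1, by simp, .loopFalse (by simp [Test.Holds, hreg, hreg0])⟩
      | succ m ihm =>
        intro k hk
        obtain ⟨t, ht, et⟩ := ihm (k + 1) (by omega)
        obtain ⟨s, hs, es⟩ := ih h0.2 hpw (f^[k] (σ.setReg i 0))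
        rw [hreg0] at hs
        refine ⟨1 + (s + 1) + t, ?_, .loopTrue ?_ (.seq es (.instr (.succ i) _)) ?_⟩
        · rw [Nat.succ_mul]; omega
        · simp only [Test.Holds, hreg, hreg0]; omega
        · convert et using 1
          rw [Function.iterate_succ_apply']
          simp only [hf, Instr.apply, State.setReg, (frame_run p _).reg i hpi]
    obtain ⟨t, ht, et⟩ := key n 0 (by omega)
    refine ⟨1 + t, ?_, .seq (.instr (.const i 0) σ) et⟩
    simp [cost]; omega

/-- The weakest precondition: `Q` holds after the block has been run from `σ`. -/
def wp (p : Block) (Q : State → Prop) (σ : State) : Prop := Q (p.run σ)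

@[simp] theorem wp_skip (Q : State → Prop) (σ : State) : wp skip Q σ = Q σ := rfl

@[simp] theorem wp_seq (p q : Block) (Q : State → Prop) (σ : State) :
    wp (p ⨾ q) Q σ = wp p (wp q Q) σ := rfl

@[simp] theorem wp_const (r c : ℕ) (Q : State → Prop) (σ : State) :
    wp (instr (.const r c)) Q σ = Q (σ.setReg r c) := rfl

@[simp] theorem wp_copy (r s : ℕ) (Q : State → Prop) (σ : State) :
    wp (instr (.copy r s)) Q σ = Q (σ.setReg r (σ.reg s)) := rfl

@[simp] theorem wp_succ (r : ℕ) (Q : State → Prop) (σ : State) :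
    wp (instr (.succ r)) Q σ = Q (σ.setReg r (σ.reg r + 1)) := rfl

@[simp] theorem wp_load (r a s : ℕ) (Q : State → Prop) (σ : State) :
    wp (instr (.load r a s)) Q σ = Q (σ.setReg r (σ.arr a (σ.reg s))) := rfl

@[simp] theorem wp_store (a s r : ℕ) (Q : State → Prop) (σ : State) :
    wp (instr (.store a s r)) Q σ = Q (σ.setArr a (σ.reg s) (σ.reg r)) := rfl

@[simp] theorem wp_cond (b : Test) (p q : Block) (Q : State → Prop) (σ : State) :
    wp (cond b p q) Q σ ↔ (b.Holds σ → wp p Q σ) ∧ (¬ b.Holds σ → wp q Q σ) := by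
  by_cases h : b.Holds σ <;> simp [wp, run, h]

/-- What a block leaves untouched is decided syntactically, so this part of a specification can be
split off, and only the values that are written have to be followed. -/
theorem wp_frame {p : Block} {Q : State → Prop} {σ : State}
    (h : wp p (fun τ => Frame p σ τ → Q τ) σ) : wp p Q σ := h (frame_run p σ)

theorem wp_mono {p : Block} {Q R : State → Prop} {σ : State} (h : wp p Q σ)
    (hQR : ∀ τ, Frame p σ τ → Q τ → R τ) : wp p R σ := hQR _ (frame_run p σ) h

/-- The loop rule: `I k` is an invariant that holds before the pass with counter value `k`. -/
theorem wp_forN {i : ℕ} {p : Block} {Q : State → Prop} {σ : State} (I : ℕ → State → Prop)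
    (hp : p.keeps i = true) (h0 : I 0 (σ.setReg i 0))
    (hs : ∀ k τ, k < σ.reg 0 → τ.reg i = k → Frame (forN i p) σ τ → I k τ →
      wp p (fun τ' => I (k + 1) (τ'.setReg i (k + 1))) τ)
    (hQ : ∀ τ, Frame (forN i p) σ τ → I (σ.reg 0) τ → Q τ) : wp (forN i p) Q σ := by
  refine hQ _ (frame_run _ σ) ?_
  rw [run]
  have : ∀ k ≤ σ.reg 0,
      I k ((fun τ => (p.run τ).setReg i (τ.reg i + 1))^[k] (σ.setReg i 0)) := by
    intro k
    induction k with
    | zero => exact fun _ => h0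
    | succ k ih =>
      intro hk
      rw [Function.iterate_succ_apply']
      have := hs k _ (by omega) (iterate_reg hp k σ) (frame_iterate (frame_run p) k σ)
        (ih (by omega))
      rwa [iterate_reg hp]
  exact this _ le_rfl

theorem haltsWithin_compile {p : Block} {Q : State → Prop} {σ : State} (h0 : p.keeps 0 = true)
    (hp : p.wf = true) (h : wp p Q σ) : HaltsWithin p.compile σ (p.cost.eval (σ.reg 0)) Q := by
  obtain ⟨t, ht, e⟩ := exec_compile p h0 hp σ
  exact ⟨t, ht, _, e, h⟩

end Block

/-- The rule for while loops: `I x` is an invariant that holds whenever `x ≥ 0` is the value of a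
potential, and each pass decreases the potential by at least one. -/
theorem haltsWithin_loop {b : Test} {p : Block} (h0 : p.keeps 0 = true) (hp : p.wf = true) {n : ℕ}
    (I : ℝ → State → Prop) (hn : ∀ x σ, I x σ → σ.reg 0 = n ∧ 0 ≤ x)
    (hs : ∀ x σ, I x σ → b.Holds σ → p.wp (fun τ => ∃ y ≤ x - 1, I y τ) σ)
    {x : ℝ} {σ : State} (h : I x σ) :
    HaltsWithin (.loop b p.compile) σ (1 + ⌊x⌋₊ * (p.cost.eval n + 1))
      fun τ => (∃ y, I y τ) ∧ ¬ b.Holds τ := by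
  suffices ∀ (m : ℕ) (x : ℝ) (σ : State), I x σ → x < m + 1 →
      HaltsWithin (.loop b p.compile) σ (1 + m * (p.cost.eval n + 1))
        fun τ => (∃ y, I y τ) ∧ ¬ b.Holds τ from this _ x σ h (Nat.lt_floor_add_one x)
  intro m
  induction m with
  | zero =>
    intro x σ h hx
    -- A further pass would make the potential negative.
    have hb : ¬ b.Holds σ := by
      intro hb
      obtain ⟨y, hy, hy'⟩ := hs x σ h hb
      have := (hn _ _ hy').2
      simp only [Nat.cast_zero, zero_add] at hx
      linarith
    exact ⟨1, by simp, σ, .loopFalse hb, ⟨x, h⟩, hb⟩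
  | succ m ih =>
    intro x σ h hx
    by_cases hb : b.Holds σ
    · obtain ⟨y, hy, hy'⟩ := hs x σ h hb
      obtain ⟨s, hs, es⟩ := p.exec_compile h0 hp σ
      obtain ⟨t, ht, τ, et, hτ⟩ := ih y _ hy' (by push_cast at hx; linarith)
      rw [(hn _ _ h).1] at hs
      refine ⟨1 + s + t, ?_, τ, .loopTrue hb es et, hτ⟩
      rw [Nat.succ_mul]; omega
    · exact ⟨1, by simp, σ, .loopFalse hb, ⟨x, h⟩, hb⟩

end RAM

/-! ### Maximum adjacency orderings of hypergraphs -/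

namespace CutAlgorithm

section Ordering

variable {ι : Type*} (s : Finset ι) (w : ι → ℕ) (E : ι → ℕ → Prop)

open Classical in
/-- The total weight of the hyperedges with property `P`. -/
noncomputable def weight (P : ι → Prop) : ℕ := ∑ i ∈ s with P i, w i

variable {s w E}

theorem weight_mono {P Q : ι → Prop} (h : ∀ i ∈ s, P i → Q i) : weight s w P ≤ weight s w Q := by
  classical
  refine Finset.sum_le_sum_of_subset fun i hi => ?_
  rw [Finset.mem_filter] at hi ⊢
  exact ⟨hi.1, h i hi.1 hi.2⟩

theorem weight_congr {P Q : ι → Prop} (h : ∀ i ∈ s, P i ↔ Q i) : weight s w P = weight s w Q :=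
  le_antisymm (weight_mono fun i hi => (h i hi).1) (weight_mono fun i hi => (h i hi).2)

theorem weight_le_add {P Q R : ι → Prop} (h : ∀ i ∈ s, P i → Q i ∨ R i) :
    weight s w P ≤ weight s w Q + weight s w R := by
  classical
  simp only [weight, Finset.sum_filter, ← Finset.sum_add_distrib]
  refine Finset.sum_le_sum fun i hi => ?_
  have := h i hi
  split_ifs <;> simp_all

theorem weight_add_le {P Q R : ι → Prop} (hP : ∀ i ∈ s, P i → R i) (hQ : ∀ i ∈ s, Q i → R i)
    (hPQ : ∀ i ∈ s, P i → ¬ Q i) : weight s w P + weight s w Q ≤ weight s w R := by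
  classical
  simp only [weight, Finset.sum_filter, ← Finset.sum_add_distrib]
  refine Finset.sum_le_sum fun i hi => ?_
  have := hP i hi
  have := hQ i hi
  have := hPQ i hi
  split_ifs <;> simp_all

variable (s w E)

/-- The hyperedge `i` contains `u` and meets `W`. -/
def Links (W : ℕ → Prop) (u : ℕ) (i : ι) : Prop := (∃ l, E i l ∧ W l) ∧ E i u

/-- The part of the hyperedge `i` in `W` is not monochromatic under `χ`. -/
def Splits (χ W : ℕ → Prop) (i : ι) : Prop := (∃ l, E i l ∧ W l ∧ χ l) ∧ ∃ l, E i l ∧ W l ∧ ¬ χ l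

/-- The invariant of a maximum adjacency ordering of the vertices in `R` that starts with the
vertices in `W`, of which `last` is the last one. -/
def Follows (R W : ℕ → Prop) (last : ℕ) : Prop :=
  ∀ χ : ℕ → Prop, ∃ W₀ : ℕ → Prop, (∀ l, W₀ l → W l) ∧ (∀ l, W l → ¬ W₀ l → (χ l ↔ χ last)) ∧
    ∀ u, R u → ¬ W u →
      weight s w (Links E W₀ u) ≤ weight s w fun i => (∃ l, E i l ∧ W₀ l) ∧ Splits E χ W i

variable {s w E}

theorem follows_singleton (R : ℕ → Prop) (x : ℕ) : Follows s w E R (fun l => l = x) x := by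
  refine fun χ => ⟨fun _ => False, fun l hl => hl.elim, fun l hl _ => by rw [hl], fun u _ _ => ?_⟩
  exact weight_mono fun i _ hi => by obtain ⟨⟨l, -, h⟩, -⟩ := hi; exact h.elim

/-- Split the hyperedges that link `W` to `x` by whether they meet `W₀`. The invariant bounds those
that do. The others contain `x` and a vertex of `W` outside of `W₀`, colored like `last` and hence
unlike `x`, so they are split themselves. The two kinds of split hyperedges are disjoint. -/
theorem Follows.links_le {R W : ℕ → Prop} {last x : ℕ} (h : Follows s w E R W last) (hR : R x)
    (hW : ¬ W x) {χ : ℕ → Prop} (hχ : ¬ (χ last ↔ χ x)) :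
    weight s w (Links E W x) ≤ weight s w (Splits E χ fun l => W l ∨ l = x) := by
  obtain ⟨W₀, hsub, hmono, hle⟩ := h χ
  have h1 : weight s w (Links E W x) ≤ weight s w (Links E W₀ x) +
      weight s w (fun i => (¬ ∃ l, E i l ∧ W₀ l) ∧ Links E W x i) := by
    refine weight_le_add fun i _ hi => ?_
    by_cases h0 : ∃ l, E i l ∧ W₀ l
    · exact .inl ⟨h0, hi.2⟩
    · exact .inr ⟨h0, hi⟩
  refine h1.trans ((Nat.add_le_add_right (hle x hR hW) _).trans (weight_add_le ?_ ?_ ?_))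
  · rintro i - ⟨-, ⟨l, a1, a2, a3⟩, ⟨m, b1, b2, b3⟩⟩
    exact ⟨⟨l, a1, .inl a2, a3⟩, ⟨m, b1, .inl b2, b3⟩⟩
  · rintro i - ⟨h0, ⟨⟨l, hl, hWl⟩, hx⟩⟩
    have hcl := hmono l hWl fun h => h0 ⟨l, hl, h⟩
    by_cases hxx : χ x
    · exact ⟨⟨x, hx, .inr rfl, hxx⟩, ⟨l, hl, .inl hWl, by tauto⟩⟩
    · exact ⟨⟨l, hl, .inl hWl, by tauto⟩, ⟨x, hx, .inr rfl, hxx⟩⟩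
  · rintro i - ⟨h0, -⟩ ⟨h1, -⟩
    exact h1 h0

/-- The set `W₀` consists of the vertices chosen before the latest change of color. It is kept if
`x` has the color of `last`. Otherwise the old `W` replaces it, and the maximality of `x` carries
the bound of `Follows.links_le` over to all other vertices. -/
theorem Follows.insert {R W : ℕ → Prop} {last x : ℕ} (h : Follows s w E R W last) (hR : R x)
    (hW : ¬ W x)
    (hmax : ∀ u, R u → ¬ W u → weight s w (Links E W u) ≤ weight s w (Links E W x)) :
    Follows s w E R (fun l => W l ∨ l = x) x := by
  intro χ
  by_cases hχ : χ last ↔ χ x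
  · obtain ⟨W₀, hsub, hmono, hle⟩ := h χ
    refine ⟨W₀, fun l hl => .inl (hsub l hl), ?_, fun u hu hWu => ?_⟩
    · rintro l (hl | rfl) h0
      · exact (hmono l hl h0).trans hχ
      · rfl
    · refine (hle u hu fun h => hWu (.inl h)).trans (weight_mono ?_)
      rintro i - ⟨h0, ⟨l, a1, a2, a3⟩, ⟨m, b1, b2, b3⟩⟩
      exact ⟨h0, ⟨l, a1, .inl a2, a3⟩, ⟨m, b1, .inl b2, b3⟩⟩
  · refine ⟨W, fun l => .inl, ?_, fun u hu hWu => ?_⟩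
    · rintro l (hl | rfl) h0
      · exact absurd hl h0
      · rfl
    · refine (hmax u hu fun h => hWu (.inl h)).trans ((h.links_le hR hW hχ).trans
        (weight_mono ?_))
      rintro i - ⟨⟨l, a1, a2, a3⟩, ⟨m, b1, b2, b3⟩⟩
      refine ⟨?_, ⟨l, a1, a2, a3⟩, ⟨m, b1, b2, b3⟩⟩
      -- The two differently colored vertices cannot both be `x`, so one of them lies in `W`.
      rcases a2 with a2 | rfl
      · exact ⟨l, a1, a2⟩
      rcases b2 with b2 | rfl
      · exact ⟨m, b1, b2⟩
      exact absurd a3 b3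

/-- The state of the computation of a maximum adjacency ordering of `R`: the vertices in `W` have
been chosen, and the last two of them are `prev` and `last` (or `n` if there are none). -/
structure Ordering (n : ℕ) (R W : ℕ → Prop) (last prev : ℕ) : Prop where
  subset : ∀ l, W l → R l
  cases : ((∀ l, ¬ W l) ∧ last = n ∧ prev = n) ∨
    (W last ∧ Follows s w E R W last ∧ ((prev = n ∧ ∀ l, W l → l = last) ∨
      (W prev ∧ prev ≠ last ∧ ∀ χ : ℕ → Prop, ¬ (χ prev ↔ χ last) →
        weight s w (Links E (fun l => W l ∧ l ≠ last) last) ≤ weight s w (Splits E χ W))))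

theorem Ordering.empty (n : ℕ) (R : ℕ → Prop) :
    Ordering (s := s) (w := w) (E := E) n R (fun _ => False) n n :=
  ⟨fun _ h => h.elim, .inl ⟨fun _ h => h, rfl, rfl⟩⟩

theorem Ordering.insert {n : ℕ} {R W : ℕ → Prop} {last prev x : ℕ}
    (h : Ordering (s := s) (w := w) (E := E) n R W last prev) (hR : R x) (hW : ¬ W x)
    (hmax : ∀ u, R u → ¬ W u → weight s w (Links E W u) ≤ weight s w (Links E W x)) :
    Ordering (s := s) (w := w) (E := E) n R (fun l => W l ∨ l = x) x last := by
  refine ⟨fun l hl => hl.elim (h.subset l) fun e => e ▸ hR, .inr ⟨.inr rfl, ?_⟩⟩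
  rcases h.cases with ⟨h0, hl, -⟩ | ⟨hl, hF, -⟩
  · have : (fun l => W l ∨ l = x) = fun l => l = x := by
      funext l; simp [h0 l]
    rw [this]
    exact ⟨follows_singleton R x, .inl ⟨hl, fun l h => h.resolve_left (h0 l)⟩⟩
  · refine ⟨hF.insert hR hW hmax, .inr ⟨.inl hl, fun e => hW (e ▸ hl), fun χ hχ => ?_⟩⟩
    refine le_trans (weight_mono ?_) (hF.links_le hR hW hχ)
    rintro i - ⟨⟨l, h1, h2, h3⟩, h4⟩
    exact ⟨⟨l, h1, h2.resolve_right h3⟩, h4⟩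

end Ordering

/-! ### Cuts of the graph left by a vertex set, and their contraction -/

section Cuts

variable (n : ℕ) (N : ℕ → ℕ → Prop) (T : ℕ → Prop)

/-- `X` defines a partition of the complement of `T` into two nonempty parts. -/
def Nontrivial (X : ℕ → Prop) : Prop := (∃ x < n, ¬ T x ∧ X x) ∧ ∃ x < n, ¬ T x ∧ ¬ X x

/-- The closed neighborhood of `v` meets both parts of the partition defined by `X`. -/
def Separated (X : ℕ → Prop) (v : ℕ) : Prop :=
  (∃ x < n, N v x ∧ ¬ T x ∧ X x) ∧ ∃ x < n, N v x ∧ ¬ T x ∧ ¬ X x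

open Classical in
/-- Vertices of `T` have weight one, and those outside of `T` are too heavy to be separated. -/
noncomputable def vertexWeight (v : ℕ) : ℕ := if T v then 1 else n

/-- The weight of the vertices that are separated by `X`. -/
noncomputable def cutWeight (X : ℕ → Prop) : ℕ :=
  weight (Finset.range n) (vertexWeight n T) (Separated n N T X)

/-- `c` labels the vertices outside of `T` by representatives of classes, and those in `T` by
`n`. -/
structure Labels (c : ℕ → ℕ) : Prop where
  top : ∀ x < n, T x → c x = n
  lt : ∀ x < n, ¬ T x → c x < n
  idem : ∀ x < n, ¬ T x → c (c x) = c x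

/-- The classes of the labelling `c` are monochromatic under `X`. -/
def Respects (c : ℕ → ℕ) (X : ℕ → Prop) : Prop := ∀ x < n, ¬ T x → (X x ↔ X (c x))

/-- `u` represents a class of the labelling `c`. -/
def Rep (c : ℕ → ℕ) (u : ℕ) : Prop := u < n ∧ c u = u

/-- The labels that occur in the closed neighborhood of `v`. -/
def LabelEdge (c : ℕ → ℕ) (v l : ℕ) : Prop := ∃ x < n, N v x ∧ c x = l

variable {n N T}

theorem Labels.top_iff {c : ℕ → ℕ} (h : Labels n T c) {x : ℕ} (hx : x < n) : c x = n ↔ T x := by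
  by_cases hT : T x
  · simp [hT, h.top x hx hT]
  · simp [hT, (h.lt x hx hT).ne]

theorem Labels.rep {c : ℕ → ℕ} (h : Labels n T c) {x : ℕ} (hx : x < n) (hT : ¬ T x) :
    Rep n c (c x) := ⟨h.lt x hx hT, h.idem x hx hT⟩

theorem Labels.not_of_rep {c : ℕ → ℕ} (h : Labels n T c) {u : ℕ} (hu : Rep n c u) : ¬ T u := by
  intro hT
  have := h.top u hu.1 hT
  have := hu.1
  have := hu.2
  omega

theorem Labels.not_of_label {c : ℕ → ℕ} (h : Labels n T c) {x : ℕ} (hx : x < n)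
    (hu : Rep n c (c x)) : ¬ T x := fun hT => (h.top x hx hT ▸ hu.1).false

open Classical in
theorem labels_init {c : ℕ → ℕ} (hc : ∀ x < n, c x = if T x then n else x) : Labels n T c := by
  have (x) (hx : x < n) (hT : ¬ T x) : c x = x := by rw [hc x hx, if_neg hT]
  refine ⟨fun x hx hT => ?_, fun x hx hT => ?_, fun x hx hT => ?_⟩
  · rw [hc x hx, if_pos hT]
  · rwa [this x hx hT]
  · rw [this x hx hT, this x hx hT]

open Classical in
theorem respects_init {c : ℕ → ℕ} (hc : ∀ x < n, c x = if T x then n else x) (X : ℕ → Prop) :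
    Respects n T c X := by
  intro x hx hT
  rw [hc x hx, if_neg hT]

theorem Labels.merge {c c' : ℕ → ℕ} (h : Labels n T c) {a b : ℕ} (ha : Rep n c a)
    (hb : Rep n c b) (hab : b ≠ a) (hc' : ∀ x < n, c' x = if c x = a then b else c x) :
    Labels n T c' := by
  have hlt (x) (hx : x < n) (hT : ¬ T x) : c' x < n := by
    rw [hc' x hx]
    split_ifs
    exacts [hb.1, h.lt x hx hT]
  refine ⟨fun x hx hT => ?_, hlt, fun x hx hT => ?_⟩
  · rw [hc' x hx, h.top x hx hT, if_neg ha.1.ne']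
  · rw [hc' _ (hlt x hx hT), hc' x hx]
    by_cases hc : c x = a
    · rw [if_pos hc, hb.2, if_neg hab]
    · rw [if_neg hc, h.idem x hx hT, if_neg hc]

theorem Respects.merge {c c' : ℕ → ℕ} {X : ℕ → Prop} (h : Respects n T c X) {a b : ℕ}
    (hX : X b ↔ X a) (hc' : ∀ x < n, c' x = if c x = a then b else c x) : Respects n T c' X := by
  intro x hx hT
  rw [h x hx hT, hc' x hx]
  split_ifs with hc
  · rw [hc, hX]
  · rfl

/-- The label `a` stops being a representative and no new one arises, so each merge lowers the
number of classes. -/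
theorem rep_merge {c c' : ℕ → ℕ} {a b : ℕ} (hb : Rep n c b) (hab : b ≠ a)
    (hc' : ∀ x < n, c' x = if c x = a then b else c x) {u : ℕ} (hu : Rep n c' u) :
    Rep n c u ∧ u ≠ a := by
  obtain ⟨h1, h2⟩ := hu
  rw [hc' u h1] at h2
  split_ifs at h2 with h3
  · subst h2
    exact absurd (hb.2.symm.trans h3) hab
  · exact ⟨⟨h1, h2⟩, fun e => h3 (by rw [h2, e])⟩

/-- Vertices of `T` carry the label `n`, which is never a representative; restricting to
representatives thus removes `T` from the closed neighborhoods, and `X` can be evaluated on labels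
because it is constant on classes. -/
theorem splits_iff {c : ℕ → ℕ} (h : Labels n T c) {X : ℕ → Prop} (hX : Respects n T c X)
    (v : ℕ) : Splits (LabelEdge n N c) X (Rep n c) v ↔ Separated n N T X v := by
  constructor
  · rintro ⟨⟨_, ⟨x, hx, hN, rfl⟩, hr, hXx⟩, ⟨_, ⟨y, hy, hNy, rfl⟩, hr', hXy⟩⟩
    have hT := h.not_of_label hx hr
    have hT' := h.not_of_label hy hr'
    exact ⟨⟨x, hx, hN, hT, (hX x hx hT).2 hXx⟩,
      ⟨y, hy, hNy, hT', fun h => hXy ((hX y hy hT').1 h)⟩⟩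
  · rintro ⟨⟨x, hx, hN, hT, hXx⟩, ⟨y, hy, hNy, hT', hXy⟩⟩
    exact ⟨⟨_, ⟨x, hx, hN, rfl⟩, h.rep hx hT, (hX x hx hT).1 hXx⟩,
      ⟨_, ⟨y, hy, hNy, rfl⟩, h.rep hy hT', fun h => hXy ((hX y hy hT').2 h)⟩⟩

/-- Identifies the quantity maximized by the ordering with the weight of the cut that isolates one
class. -/
theorem links_iff {c : ℕ → ℕ} (h : Labels n T c) {a : ℕ} (ha : Rep n c a) (v : ℕ) :
    Links (LabelEdge n N c) (fun l => Rep n c l ∧ l ≠ a) a v ↔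
      Separated n N T (fun x => c x = a) v := by
  constructor
  · rintro ⟨⟨_, ⟨x, hx, hN, rfl⟩, hr, hne⟩, ⟨y, hy, hNy, rfl⟩⟩
    exact ⟨⟨y, hy, hNy, h.not_of_label hy ha, rfl⟩, ⟨x, hx, hN, h.not_of_label hx hr, hne⟩⟩
  · rintro ⟨⟨y, hy, hNy, hT', hXy⟩, ⟨x, hx, hN, hT, hXx⟩⟩
    exact ⟨⟨_, ⟨x, hx, hN, rfl⟩, h.rep hx hT, hXx⟩, ⟨y, hy, hNy, hXy⟩⟩

theorem nontrivial_rep {c : ℕ → ℕ} (h : Labels n T c) {a b : ℕ} (ha : Rep n c a) (hb : Rep n c b)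
    (hab : b ≠ a) : Nontrivial n T fun x => c x = a :=
  ⟨⟨a, ha.1, h.not_of_rep ha, ha.2⟩, ⟨b, hb.1, h.not_of_rep hb, fun h => hab (hb.2.symm.trans h)⟩⟩

theorem not_nontrivial {c : ℕ → ℕ} (h : Labels n T c) {X : ℕ → Prop} (hX : Respects n T c X)
    (hR : ∀ u v, Rep n c u → Rep n c v → u = v) : ¬ Nontrivial n T X := by
  rintro ⟨⟨x, hx, hT, hXx⟩, ⟨y, hy, hT', hXy⟩⟩
  refine hXy ((hX y hy hT').2 ?_)
  rw [hR _ _ (h.rep hy hT') (h.rep hx hT)]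
  exact (hX x hx hT).1 hXx

end Cuts

end CutAlgorithm

/-! ### Blocks for minimum cuts

Array `0` holds the graph, array `1` a vertex set `T`, array `2` the best solution found, array `3`
the labels of the classes, array `4` a set of labels, array `5` the current solution, and the
arrays `6` and `7` the queue and the alive vertices of the search. Register `0` holds the number of
vertices and register `1` the size of the best solution. -/

namespace CutAlgorithm

open RAM RAM.Block

/-- Register `12` becomes nonzero if the vertices in registers `10` and `11` are equal or
adjacent. -/
def nearBlock : Block :=
  instr (.const 13 0) ⨾
  forN 14 (cond (.lt 14 10) (forN 15 (instr (.succ 13))) skip) ⨾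
  forN 14 (cond (.lt 14 11) (instr (.succ 13)) skip) ⨾
  instr (.load 12 0 13) ⨾
  cond (.eq 10 11) (instr (.const 12 1)) skip

/-- Register `0` and array `0` hold the graph on `{0, …, n - 1}` with closed neighborhoods `N`. -/
def Encodes (n : ℕ) (N : ℕ → ℕ → Prop) (σ : State) : Prop :=
  σ.reg 0 = n ∧ ∀ v < n, ∀ x < n, (σ.arr 0 (v * n + x) ≠ 0 ∨ v = x) ↔ N v x

variable {n : ℕ} {N : ℕ → ℕ → Prop}

theorem Encodes.frame {p : Block} {σ τ : State} (h : Encodes n N σ) (hp : Frame p σ τ)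
    (h0 : p.keeps 0 = true) (ha : p.keepsArr 0 = true) : Encodes n N τ := by
  rw [Encodes, hp.reg 0 h0, hp.arr 0 ha]
  exact h

theorem wp_addN {r i : ℕ} (hri : r ≠ i) {Q : State → Prop} {σ : State}
    (hQ : ∀ τ, Frame (forN i (instr (.succ r))) σ τ → τ.reg r = σ.reg r + σ.reg 0 → Q τ) :
    wp (forN i (instr (.succ r))) Q σ := by
  refine wp_forN (fun k τ => τ.reg r = σ.reg r + k) ?_ ?_ ?_ hQ
  · simp [keeps, hri.symm]
  · simp [hri]
  · intro k τ hk hi hF hI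
    simp [hri, hI, add_assoc]

theorem wp_near {Q : State → Prop} {σ : State} (hE : Encodes n N σ) (hv : σ.reg 10 < n)
    (hx : σ.reg 11 < n)
    (hQ : ∀ τ, Frame nearBlock σ τ → (τ.reg 12 ≠ 0 ↔ N (σ.reg 10) (σ.reg 11)) → Q τ) :
    wp nearBlock Q σ := by
  refine wp_frame (wp_mono (Q := fun τ => τ.reg 12 ≠ 0 ↔ N (σ.reg 10) (σ.reg 11)) ?_
    fun τ hF h _ => hQ τ hF h)
  have h0 := hE.1
  simp only [nearBlock, wp_seq, wp_const]
  -- Without multiplication, `v * n + x` is computed by counting. The counter runs up to `n`, but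
  -- the guard lets only the passes below `reg 10` contribute; hence the `min`.
  refine wp_forN (fun k τ => τ.reg 13 = min k (σ.reg 10) * n) rfl (by simp) ?_ ?_
  · intro k τ hk hi hF hI
    have h10 := hF.reg 10 rfl
    simp only [State.setReg_reg] at h10 hk
    simp [h0] at h10 hk
    simp [Test.Holds, hi, h10]
    refine ⟨fun hlt => wp_addN (by decide) ?_, fun hlt => ?_⟩
    · intro τ' hF' h13
      have h0' := hF.reg 0 rfl
      simp at h0'
      simp [h13, hI, h0', h0, min_eq_left hlt.le, min_eq_left (Nat.succ_le_of_lt hlt), Nat.succ_mul]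
    · rw [hI, min_eq_right hlt, min_eq_right (by omega)]
  · intro τ hF hI
    simp [h0, min_eq_right hv.le] at hI
    have hF0 := hF.reg 0 rfl
    have hF10 := hF.reg 10 rfl
    have hF11 := hF.reg 11 rfl
    have hA := hF.arr 0 rfl
    simp [h0] at hF0 hF10 hF11 hA
    rw [wp_seq]
    refine wp_forN (fun k τ' => τ'.reg 13 = σ.reg 10 * n + min k (σ.reg 11)) rfl (by simp [hI]) ?_ ?_
    · intro k τ' hk hi hF' hI'
      have h11 := hF'.reg 11 rfl
      simp [Test.Holds, hi, h11, hF11, hI']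
      omega
    · intro τ' hF' hI'
      have hF0' := hF'.reg 0 rfl
      have hF10' := hF'.reg 10 rfl
      have hF11' := hF'.reg 11 rfl
      have hA' := hF'.arr 0 rfl
      rw [hF0, min_eq_right hx.le] at hI'
      have := hE.2 _ hv _ hx
      simp [Test.Holds, hI', hA', hA, hF10', hF11', hF10, hF11]
      rw [← this]
      by_cases he : σ.reg 10 = σ.reg 11 <;> simp [he]

/-- Register `20` becomes `1` or `0` according to whether the closed neighborhood of the vertex in
register `10` contains both a label that is marked in array `4`, and the label in register `6`. -/
def scanBlock : Block :=
  instr (.const 16 0) ⨾ instr (.const 17 0) ⨾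
  forN 11 (nearBlock ⨾
    cond (.nonzero 12)
      (instr (.load 18 3 11) ⨾ instr (.load 19 4 18) ⨾
        cond (.nonzero 19) (instr (.const 16 1)) skip ⨾
        cond (.eq 18 6) (instr (.const 17 1)) skip)
      skip) ⨾
  instr (.const 20 0) ⨾
  cond (.nonzero 16) (cond (.nonzero 17) (instr (.const 20 1)) skip) skip

open Classical in
theorem wp_scan {Q : State → Prop} {σ : State} (hE : Encodes n N σ) (hv : σ.reg 10 < n)
    (hQ : ∀ τ, Frame scanBlock σ τ →
      τ.reg 20 = (if Links (LabelEdge n N (σ.arr 3)) (fun l => σ.arr 4 l ≠ 0) (σ.reg 6) (σ.reg 10)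
        then 1 else 0) → Q τ) :
    wp scanBlock Q σ := by
  refine wp_frame (wp_mono (Q := fun τ => τ.reg 20 = if Links _ _ _ _ then 1 else 0) ?_
    fun τ hF h _ => hQ τ hF h)
  have h0 := hE.1
  simp only [scanBlock, wp_seq, wp_const]
  refine wp_forN (fun k τ =>
    (τ.reg 16 ≠ 0 ↔ ∃ x < k, N (σ.reg 10) x ∧ σ.arr 4 (σ.arr 3 x) ≠ 0) ∧
    (τ.reg 17 ≠ 0 ↔ ∃ x < k, N (σ.reg 10) x ∧ σ.arr 3 x = σ.reg 6)) rfl (by simp) ?_ ?_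
  · rintro k τ hk hi hF ⟨hI1, hI2⟩
    have hF0 := hF.reg 0 rfl
    have hF6 := hF.reg 6 rfl
    have hF10 := hF.reg 10 rfl
    have hA0 := hF.arr 0 rfl
    have hA3 := hF.arr 3 rfl
    have hA4 := hF.arr 4 rfl
    simp [h0] at hF0 hF6 hF10 hA0 hA3 hA4 hk
    rw [wp_seq]
    refine wp_near (n := n) (N := N) ⟨hF0, by rw [hA0]; exact hE.2⟩ (by omega) (by omega)
      fun τ' hF' hN => ?_
    have hG0 := hF'.reg 0 rfl
    have hG6 := hF'.reg 6 rfl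
    have hG11 := hF'.reg 11 rfl
    have hG16 := hF'.reg 16 rfl
    have hG17 := hF'.reg 17 rfl
    have hB3 := hF'.arr 3 rfl
    have hB4 := hF'.arr 4 rfl
    rw [hF10, hi] at hN
    simp only [Nat.lt_succ_iff_lt_or_eq, or_and_right, exists_or, exists_eq_left]
    simp only [wp_cond, wp_seq, wp_load, wp_const, wp_skip, Test.Holds, State.setReg_reg,
      State.setReg_arr, hG6, hG11, hG16, hG17, hB3, hB4, hA3, hA4, hF6, hi, hN]
    simp only [← hI1, ← hI2]
    by_cases h1 : N (σ.reg 10) k <;> by_cases h2 : σ.arr 4 (σ.arr 3 k) = 0 <;>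
      by_cases h3 : σ.arr 3 k = σ.reg 6 <;> try rw [h3] at h2
    all_goals simp [h1, h2, h3]
  · rintro τ hF ⟨hI1, hI2⟩
    simp [h0] at hI1 hI2
    have : Links (LabelEdge n N (σ.arr 3)) (fun l => σ.arr 4 l ≠ 0) (σ.reg 6) (σ.reg 10) ↔
        τ.reg 16 ≠ 0 ∧ τ.reg 17 ≠ 0 := by
      simp only [Links, LabelEdge, ne_eq, hI1, hI2]
      refine and_congr_left fun _ => ⟨?_, ?_⟩
      · rintro ⟨_, ⟨x, hx, hN, rfl⟩, h⟩
        exact ⟨x, hx, hN, h⟩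
      · rintro ⟨x, hx, hN, h⟩
        exact ⟨_, ⟨x, hx, hN, rfl⟩, h⟩
    simp only [this]
    by_cases h1 : τ.reg 16 = 0 <;> by_cases h2 : τ.reg 17 = 0 <;> simp [Test.Holds, h1, h2]

/-- Adds the weight of the vertex in register `10` to register `7`. -/
def addWeightBlock : Block :=
  instr (.load 18 3 10) ⨾ cond (.eq 18 0) (instr (.succ 7)) (forN 21 (instr (.succ 7)))

/-- Comparing the label with `n` decides membership in `T`, so array `1` need not be consulted. -/
theorem wp_addWeight {T : ℕ → Prop} {Q : State → Prop} {σ : State} (h0 : σ.reg 0 = n)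
    (hv : σ.reg 10 < n) (hc : Labels n T (σ.arr 3))
    (hQ : ∀ τ, Frame addWeightBlock σ τ → τ.reg 7 = σ.reg 7 + vertexWeight n T (σ.reg 10) → Q τ) :
    wp addWeightBlock Q σ := by
  refine wp_frame (wp_mono (Q := fun τ => τ.reg 7 = σ.reg 7 + vertexWeight n T (σ.reg 10)) ?_
    fun τ hF h _ => hQ τ hF h)
  have hT := hc.top_iff hv
  simp only [addWeightBlock, wp_seq, wp_load, wp_cond, Test.Holds]
  simp only [State.setReg_reg, h0]
  refine ⟨fun h => ?_, fun h => wp_addN (by decide) fun τ _ h7 => ?_⟩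
  · have := hT.1 (by simpa using h)
    simp [vertexWeight, this]
  · have := mt hT.2 (by simpa using h)
    simpa [vertexWeight, this, h0] using h7

/-- Register `7` becomes the weight of the hyperedges that contain the label in register `6` and
meet the set marked in array `4`; these hyperedges are marked in array `5`. -/
def linksBlock : Block :=
  instr (.const 7 0) ⨾
  forN 10 (scanBlock ⨾ instr (.store 5 10 20) ⨾ cond (.nonzero 20) addWeightBlock skip)

open Classical in
theorem weight_range_succ (k : ℕ) (w : ℕ → ℕ) (P : ℕ → Prop) :
    weight (Finset.range (k + 1)) w P =
      weight (Finset.range k) w P + if P k then w k else 0 := by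
  simp only [weight, Finset.sum_filter, Finset.sum_range_succ]

open Classical in
theorem wp_links {T : ℕ → Prop} {Q : State → Prop} {σ : State} (hE : Encodes n N σ)
    (hc : Labels n T (σ.arr 3))
    (hQ : ∀ τ, Frame linksBlock σ τ →
      τ.reg 7 = weight (Finset.range n) (vertexWeight n T)
        (Links (LabelEdge n N (σ.arr 3)) (fun l => σ.arr 4 l ≠ 0) (σ.reg 6)) →
      (∀ v < n, τ.arr 5 v = if Links (LabelEdge n N (σ.arr 3)) (fun l => σ.arr 4 l ≠ 0)
        (σ.reg 6) v then 1 else 0) → Q τ) :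
    wp linksBlock Q σ := by
  set P := Links (LabelEdge n N (σ.arr 3)) (fun l => σ.arr 4 l ≠ 0) (σ.reg 6) with hP
  refine wp_frame (wp_mono (Q := fun τ =>
    τ.reg 7 = weight (Finset.range n) (vertexWeight n T) P ∧
      ∀ v < n, τ.arr 5 v = if P v then 1 else 0) ?_ fun τ hF h _ => hQ τ hF h.1 h.2)
  have h0 := hE.1
  simp only [linksBlock, wp_seq, wp_const]
  refine wp_forN (fun k τ => τ.reg 7 = weight (Finset.range k) (vertexWeight n T) P ∧
      ∀ v < k, τ.arr 5 v = if P v then 1 else 0) rfl (by simp [weight]) ?_ ?_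
  · rintro k τ hk hi hF ⟨hI1, hI2⟩
    have hF0 := hF.reg 0 rfl
    have hF6 := hF.reg 6 rfl
    have hA0 := hF.arr 0 rfl
    have hA3 := hF.arr 3 rfl
    have hA4 := hF.arr 4 rfl
    simp [h0] at hF0 hF6 hA0 hA3 hA4 hk
    rw [wp_seq]
    refine wp_scan (n := n) (N := N) ⟨hF0, by rw [hA0]; exact hE.2⟩ (by omega)
      fun τ' hF' h20 => ?_
    have hG0 := hF'.reg 0 rfl
    have hG7 := hF'.reg 7 rfl
    have hG10 := hF'.reg 10 rfl
    have hB3 := hF'.arr 3 rfl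
    have hB5 := hF'.arr 5 rfl
    rw [hA3, hA4, hF6, hi, ← hP] at h20
    have hS : ∀ v < k + 1, Function.update (τ.arr 5) k (τ'.reg 20) v = if P v then 1 else 0 := by
      intro v hv
      rcases Nat.lt_succ_iff_lt_or_eq.1 hv with hv | rfl
      · rw [Function.update_of_ne hv.ne, hI2 v hv]
      · rw [Function.update_self, h20]
    simp only [wp_seq, wp_store, wp_cond, Test.Holds, State.setArr_reg, hG10, hi, h20]
    refine ⟨fun h => ?_, fun h => ?_⟩
    · have hPk : P k := by by_contra hPk; simp [hPk] at h
      refine wp_addWeight (n := n) (T := T) (by simpa [hG0] using hF0) (by simp [hG10, hi, hk])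
        (by simpa [hB3, hA3] using hc) fun τ'' hF'' h7 => ⟨?_, ?_⟩
      · simp [h7, hG7, hI1, hG10, hi, weight_range_succ, hPk]
      · have := hF''.arr 5 rfl
        simpa [this, hB5, hPk, h20] using hS
    · have hPk : ¬ P k := by by_contra hPk; simp [hPk] at h
      rw [wp_skip]
      refine ⟨?_, ?_⟩
      · simp [hG7, hI1, weight_range_succ, hPk]
      · simpa [hB5, hPk, h20] using hS
  · intro τ _ h
    simpa [h0] using h

end CutAlgorithm

/-! ### Computing a maximum adjacency ordering -/

namespace CutAlgorithm

open RAM RAM.Block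

variable {n : ℕ} {N : ℕ → ℕ → Prop} {T : ℕ → Prop}

/-- Register `4` becomes the representative outside of the set marked in array `4` that is linked
to this set by the hyperedges of largest total weight, or `n` if there is none. -/
def pickBlock : Block :=
  instr (.copy 4 0) ⨾ instr (.const 5 0) ⨾
  forN 6
    (instr (.load 18 3 6) ⨾ instr (.load 19 4 6) ⨾
      cond (.eq 18 6)
        (cond (.nonzero 19) skip
          (linksBlock ⨾
            cond (.eq 4 0) (instr (.copy 4 6) ⨾ instr (.copy 5 7))
              (cond (.lt 5 7) (instr (.copy 4 6) ⨾ instr (.copy 5 7)) skip)))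
        skip)

/-- The weight of the hyperedges that link the label `u` to the set `W`. -/
noncomputable abbrev linkWeight (n : ℕ) (N : ℕ → ℕ → Prop) (T : ℕ → Prop) (c : ℕ → ℕ)
    (W : ℕ → Prop) (u : ℕ) : ℕ :=
  weight (Finset.range n) (vertexWeight n T) (Links (LabelEdge n N c) W u)

theorem wp_pick {Q : State → Prop} {σ : State} (hE : Encodes n N σ) (hc : Labels n T (σ.arr 3))
    (hQ : ∀ τ, Frame pickBlock σ τ →
      (τ.reg 4 = n ∧ ∀ u, Rep n (σ.arr 3) u → σ.arr 4 u ≠ 0) ∨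
      (Rep n (σ.arr 3) (τ.reg 4) ∧ σ.arr 4 (τ.reg 4) = 0 ∧
        ∀ u, Rep n (σ.arr 3) u → σ.arr 4 u = 0 →
          linkWeight n N T (σ.arr 3) (fun l => σ.arr 4 l ≠ 0) u ≤
            linkWeight n N T (σ.arr 3) (fun l => σ.arr 4 l ≠ 0) (τ.reg 4)) → Q τ) :
    wp pickBlock Q σ := by
  set L := linkWeight n N T (σ.arr 3) (fun l => σ.arr 4 l ≠ 0) with hL
  refine wp_frame (wp_mono (Q := fun τ =>
    (τ.reg 4 = n ∧ ∀ u, Rep n (σ.arr 3) u → σ.arr 4 u ≠ 0) ∨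
      (Rep n (σ.arr 3) (τ.reg 4) ∧ σ.arr 4 (τ.reg 4) = 0 ∧
        ∀ u, Rep n (σ.arr 3) u → σ.arr 4 u = 0 → L u ≤ L (τ.reg 4))) ?_ fun τ hF h _ => hQ τ hF h)
  have h0 := hE.1
  simp only [pickBlock, wp_seq, wp_copy, wp_const]
  -- The value `n` of register `4` says that no candidate has been met; only otherwise does register
  -- `5` matter.
  refine wp_forN (fun k τ =>
    (τ.reg 4 = n ∧ ∀ u < k, σ.arr 3 u = u → σ.arr 4 u ≠ 0) ∨
      (Rep n (σ.arr 3) (τ.reg 4) ∧ σ.arr 4 (τ.reg 4) = 0 ∧ τ.reg 5 = L (τ.reg 4) ∧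
        ∀ u < k, σ.arr 3 u = u → σ.arr 4 u = 0 → L u ≤ L (τ.reg 4))) rfl (by simp [h0]) ?_ ?_
  · intro k τ hk hi hF hI
    have hF0 := hF.reg 0 rfl
    have hA0 := hF.arr 0 rfl
    have hA3 := hF.arr 3 rfl
    have hA4 := hF.arr 4 rfl
    simp [h0] at hF0 hA0 hA3 hA4 hk
    simp only [wp_seq, wp_load, wp_cond, Test.Holds, State.setReg_reg, State.setReg_arr, hi, hA3,
      hA4, wp_skip]
    simp only [Nat.forall_lt_succ_right]
    norm_num only [if_true, if_false, hi]
    refine ⟨fun h1 => ⟨fun h2 => ?_, fun h2 => ?_⟩, fun h1 => ?_⟩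
    · exact hI.imp (fun h => ⟨h.1, h.2, fun _ => h2⟩)
        fun h => ⟨h.1, h.2.1, h.2.2.1, h.2.2.2, fun _ h3 => absurd h3 h2⟩
    · rw [not_not] at h2
      refine wp_links (n := n) (N := N) (T := T) (by simpa [Encodes, hF0, hA0] using hE.2)
        (by simpa [hA3] using hc) fun τ' hF' h7 _ => ?_
      have hG0 := hF'.reg 0 rfl
      have hG4 := hF'.reg 4 rfl
      have hG5 := hF'.reg 5 rfl
      have hG6 := hF'.reg 6 rfl
      simp [hi, hF0] at hG0 hG4 hG5 hG6
      simp [hA3, hA4, hi] at h7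
      replace h7 : τ'.reg 7 = L k := h7
      simp only [wp_cond, Test.Holds, wp_seq, wp_copy, wp_skip, State.setReg_reg, hG4, hG5, hG6,
        hG0, h7]
      norm_num only [if_true, if_false]
      refine ⟨fun h3 => ?_, fun h3 => ⟨fun h4 => ?_, fun h4 => ?_⟩⟩
      · rcases hI with hI | hI
        · exact .inr ⟨⟨hk, h1⟩, h2, trivial, fun u hu hu1 hu2 => absurd hu2 (hI.2 u hu hu1),
            fun _ _ => le_rfl⟩
        · exact absurd h3 hI.1.1.ne
      · rcases hI with hI | hI
        · exact absurd hI.1 h3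
        · rw [hI.2.2.1] at h4
          exact .inr ⟨⟨hk, h1⟩, h2, trivial, fun u hu hu1 hu2 =>
            (hI.2.2.2 u hu hu1 hu2).trans h4.le, fun _ _ => le_rfl⟩
      · rcases hI with hI | hI
        · exact absurd hI.1 h3
        · rw [hI.2.2.1] at h4
          exact .inr ⟨hI.1, hI.2.1, hI.2.2.1, hI.2.2.2, fun _ _ => not_lt.1 h4⟩
    · exact hI.imp (fun h => ⟨h.1, h.2, fun h3 => absurd h3 h1⟩)
        fun h => ⟨h.1, h.2.1, h.2.2.1, h.2.2.2, fun h3 => absurd h3 h1⟩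
  · intro τ _ h
    simp [h0] at h
    refine h.imp (fun h => ⟨h.1, fun u hu => h.2 u hu.1 hu.2⟩)
      fun h => ⟨h.1, h.2.1, fun u hu => h.2.2.2 u hu.1 hu.2⟩

/-- One step of a maximum adjacency ordering. -/
def stepBlock : Block :=
  pickBlock ⨾
  cond (.lt 4 0)
    (instr (.copy 3 2) ⨾ instr (.copy 2 4) ⨾ instr (.const 20 1) ⨾ instr (.store 4 4 20)) skip

/-- Computes a maximum adjacency ordering of the representatives. The last two of them are left in
registers `3` and `2`, and all representatives are marked in array `4`. -/
def orderBlock : Block :=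
  instr (.const 20 0) ⨾ forN 22 (instr (.store 4 22 20)) ⨾
  instr (.copy 2 0) ⨾ instr (.copy 3 0) ⨾ forN 8 stepBlock

/-- The entry with index `n` has to be zero since `scanBlock` looks up the marks of all labels,
including the label `n` of the vertices in `T`. -/
theorem wp_order {Q : State → Prop} {σ : State} (hE : Encodes n N σ) (hc : Labels n T (σ.arr 3))
    (hW : ∀ l ≥ n, σ.arr 4 l = 0)
    (hQ : ∀ τ, Frame orderBlock σ τ → (∀ l, τ.arr 4 l ≠ 0 ↔ Rep n (σ.arr 3) l) →
      Ordering (s := Finset.range n) (w := vertexWeight n T) (E := LabelEdge n N (σ.arr 3)) n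
        (Rep n (σ.arr 3)) (Rep n (σ.arr 3)) (τ.reg 2) (τ.reg 3) → Q τ) :
    wp orderBlock Q σ := by
  set c := σ.arr 3 with hc3
  refine wp_frame (wp_mono (Q := fun τ => (∀ l, τ.arr 4 l ≠ 0 ↔ Rep n c l) ∧
      Ordering (s := Finset.range n) (w := vertexWeight n T) (E := LabelEdge n N c) n
        (Rep n c) (Rep n c) (τ.reg 2) (τ.reg 3)) ?_ fun τ hF h _ => hQ τ hF h.1 h.2)
  have h0 := hE.1
  simp only [orderBlock, wp_seq, wp_const]
  refine wp_forN (fun k τ => ∀ l, (l < k ∨ n ≤ l) → τ.arr 4 l = 0) rfl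
    (by simpa using hW) ?_ ?_
  · intro k τ hk hi hF hI
    rw [wp_store]
    intro l hl
    have h20 := hF.reg 20 rfl
    simp at h20
    simp only [hi, h20, State.setReg_arr, State.setArr_arr, if_true]
    rw [Function.update_apply]
    split_ifs with hlk
    · rfl
    · exact hI l (by omega)
  · intro τ₁ hF₁ hI₁
    simp only [State.setReg_reg] at hI₁
    norm_num only [if_false, h0] at hI₁
    replace hI₁ : ∀ l, τ₁.arr 4 l = 0 := fun l => hI₁ l (lt_or_ge l n)
    have hF0 := hF₁.reg 0 rfl
    have hA0 := hF₁.arr 0 rfl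
    have hA3 := hF₁.arr 3 rfl
    simp [h0, ← hc3] at hF0 hA0 hA3
    simp only [wp_seq, wp_copy]
    -- A pass that does not finish the ordering marks a new number below `n`. After `n` passes
    -- either all representatives are marked or all of `0, …, n - 1` are, which comes to the same.
    refine wp_forN (fun k τ =>
      Ordering (s := Finset.range n) (w := vertexWeight n T) (E := LabelEdge n N c) n
        (Rep n c) (fun l => τ.arr 4 l ≠ 0) (τ.reg 2) (τ.reg 3) ∧
      ((∀ u, Rep n c u → τ.arr 4 u ≠ 0) ∨
        k ≤ ((Finset.range n).filter fun l => τ.arr 4 l ≠ 0).card)) rfl ?_ ?_ ?_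
    · simpa [hI₁, hF0] using Ordering.empty n _
    · rintro k τ hk hi hF ⟨hO, hP⟩
      have hG0 := hF.reg 0 rfl
      have hB0 := hF.arr 0 rfl
      have hB3 := hF.arr 3 rfl
      simp [hF0, hA0, hA3] at hG0 hB0 hB3
      rw [stepBlock, wp_seq]
      refine wp_pick (n := n) (N := N) (T := T) (by simpa [Encodes, hG0, hB0] using hE.2)
        (by simpa [hB3] using hc) fun τ' hF' hD => ?_
      have hK0 := hF'.reg 0 rfl
      have hK2 := hF'.reg 2 rfl
      have hK3 := hF'.reg 3 rfl
      have hC4 := hF'.arr 4 rfl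
      simp only [wp_cond, Test.Holds, wp_seq, wp_copy, wp_const, wp_store, wp_skip]
      rw [hK0, hG0]
      rw [hB3] at hD
      refine ⟨fun hlt => ?_, fun hge => ?_⟩
      · obtain hD | ⟨hR, hx, hmax⟩ := hD
        · exact absurd hD.1 hlt.ne
        have hW' : (fun l => Function.update (τ.arr 4) (τ'.reg 4) 1 l ≠ 0) =
            fun l => τ.arr 4 l ≠ 0 ∨ l = τ'.reg 4 := by
          funext l
          by_cases hl : l = τ'.reg 4 <;> simp [hl]
        simp [hC4, hK2, -ne_eq, hW']
        refine ⟨hO.insert hR (by simpa using hx) fun u hu hWu => hmax u hu (by simpa using hWu),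
          hP.imp (fun h u hu => ?_) fun h => ?_⟩
        · exact (congr_fun hW' u).mpr (.inl (h u hu))
        · refine Nat.succ_le_of_lt (h.trans_lt (Finset.card_lt_card ?_))
          refine (Finset.ssubset_iff_of_subset ?_).2 ⟨τ'.reg 4, ?_, ?_⟩
          · intro l
            simp +contextual
          · simp [hR.1]
          · simp [hx]
      · obtain hD | hD := hD
        · simpa [hC4, hK2, hK3] using ⟨hO, .inl hD.2⟩
        · exact absurd hD.1.1 hge
    · rintro τ hF ⟨hO, hP⟩
      have : ∀ u, Rep n c u → τ.arr 4 u ≠ 0 := by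
        rcases hP with hP | hP
        · exact hP
        · intro u hu
          have h1 : (Finset.range n).filter (fun l => τ.arr 4 l ≠ 0) = Finset.range n := by
            refine Finset.eq_of_subset_of_card_le (Finset.filter_subset _ _) ?_
            simpa [hF0] using hP
          have h2 := Finset.mem_range.2 hu.1
          rw [← h1] at h2
          exact (Finset.mem_filter.1 h2).2
      have h2 : ∀ l, τ.arr 4 l ≠ 0 ↔ Rep n c l := fun l => ⟨hO.subset l, this l⟩
      refine ⟨h2, ?_⟩
      rwa [show (fun l => τ.arr 4 l ≠ 0) = Rep n c from funext fun l => propext (h2 l)] at hO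

end CutAlgorithm

/-! ### The minimum cut algorithm by repeated contraction -/

namespace CutAlgorithm

open RAM RAM.Block

variable {n : ℕ} {N : ℕ → ℕ → Prop} {T : ℕ → Prop}

/-- Replaces the best solution by the current one if the latter has smaller weight. -/
def updateBlock : Block :=
  cond (.lt 7 1) (instr (.copy 1 7) ⨾ forN 22 (instr (.load 20 5 22) ⨾ instr (.store 2 22 20))) skip

theorem wp_update {Q : State → Prop} {σ : State}
    (hQ : ∀ τ, Frame updateBlock σ τ →
      (τ.reg 1 = σ.reg 7 ∧ σ.reg 7 < σ.reg 1 ∧ ∀ v < σ.reg 0, τ.arr 2 v = σ.arr 5 v) ∨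
      (τ.reg 1 = σ.reg 1 ∧ σ.reg 1 ≤ σ.reg 7 ∧ τ.arr 2 = σ.arr 2) → Q τ) :
    wp updateBlock Q σ := by
  refine wp_frame (wp_mono (Q := fun τ =>
      (τ.reg 1 = σ.reg 7 ∧ σ.reg 7 < σ.reg 1 ∧ ∀ v < σ.reg 0, τ.arr 2 v = σ.arr 5 v) ∨
      (τ.reg 1 = σ.reg 1 ∧ σ.reg 1 ≤ σ.reg 7 ∧ τ.arr 2 = σ.arr 2)) ?_ fun τ hF h _ => hQ τ hF h)
  simp only [updateBlock, wp_cond, Test.Holds, wp_seq, wp_copy, wp_skip]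
  refine ⟨fun hlt => ?_, fun h => .inr ⟨trivial, not_lt.1 h, trivial⟩⟩
  refine wp_forN (fun k τ => ∀ v < k, τ.arr 2 v = σ.arr 5 v) rfl (by simp) ?_ ?_
  · intro k τ hk hi hF hI
    have h5 := hF.arr 5 rfl
    simp at h5
    simp only [wp_seq, wp_load, wp_store]
    simp only [Nat.forall_lt_succ_right]
    simp [hi, h5]
    intro v hv
    rw [Function.update_of_ne hv.ne, hI v hv]
  · intro τ hF hI
    have h1 := hF.reg 1 rfl
    simp at h1 hI
    exact .inl ⟨h1, hlt, hI⟩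

/-- Replaces the label in register `2` by the label in register `3`. -/
def mergeBlock : Block :=
  forN 22 (instr (.load 18 3 22) ⨾ cond (.eq 18 2) (instr (.store 3 22 3)) skip)

theorem wp_merge {Q : State → Prop} {σ : State}
    (hQ : ∀ τ, Frame mergeBlock σ τ →
      (∀ x < σ.reg 0, τ.arr 3 x = if σ.arr 3 x = σ.reg 2 then σ.reg 3 else σ.arr 3 x) → Q τ) :
    wp mergeBlock Q σ := by
  refine wp_forN (fun k τ => ∀ x, τ.arr 3 x =
    if x < k ∧ σ.arr 3 x = σ.reg 2 then σ.reg 3 else σ.arr 3 x) rfl (by simp) ?_ ?_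
  · intro k τ hk hi hF hI
    have h2 := hF.reg 2 rfl
    have h3 := hF.reg 3 rfl
    simp only [wp_seq, wp_load, wp_cond, Test.Holds, wp_store, wp_skip]
    simp [hi, h2, h3, hI]
    refine ⟨fun h x => ?_, fun h x => ?_⟩
    · by_cases hx : x = k
      · simp [hx, h]
      · rw [Function.update_of_ne hx, hI]
        have : x ≤ k ↔ x < k := by omega
        simp [this]
    · by_cases hx : x = k
      · simp [hx, h]
      · have : x ≤ k ↔ x < k := by omega
        simp [this]
  · intro τ hF hI
    refine hQ τ hF fun x hx => ?_
    simp [hI x, hx]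

/-- One phase of the minimum cut algorithm. -/
def phaseBlock : Block :=
  orderBlock ⨾
  cond (.lt 3 0)
    (instr (.const 20 0) ⨾ instr (.store 4 2 20) ⨾ instr (.copy 6 2) ⨾ linksBlock ⨾
      updateBlock ⨾ mergeBlock)
    skip

open Classical in
/-- The invariant of the minimum cut algorithm: at most `m` classes are left, or one; solutions
satisfy `V`, and all cuts that are better than the current solution respect the classes. -/
structure CutInvariant (n : ℕ) (N : ℕ → ℕ → Prop) (T : ℕ → Prop) (V : ℕ → (ℕ → ℕ) → Prop)
    (b m : ℕ) (σ : State) : Prop where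
  encodes : Encodes n N σ
  labels : Labels n T (σ.arr 3)
  zero : ∀ l ≥ n, σ.arr 4 l = 0
  le : σ.reg 1 ≤ b
  valid : V (σ.reg 1) (σ.arr 2)
  respects : ∀ X, Nontrivial n T X → σ.reg 1 ≤ cutWeight n N T X ∨ Respects n T (σ.arr 3) X
  card : ((Finset.range n).filter (Rep n (σ.arr 3))).card ≤ max 1 m

-- A cut that respects the classes either distinguishes the last two representatives, and then
-- weighs at least as much as the cut isolating `last`, which has just been compared with the best
-- solution; or it does not, and then it survives their merging.
open Classical in
theorem wp_phase {V : ℕ → (ℕ → ℕ) → Prop} {b m : ℕ} {σ : State}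
    (hV : ∀ X a, Nontrivial n T X → cutWeight n N T X < b →
      (∀ v < n, a v = if Separated n N T X v then 1 else 0) → V (cutWeight n N T X) a)
    (h : CutInvariant n N T V b m σ) :
    wp phaseBlock (CutInvariant n N T V b (m - 1)) σ := by
  rw [phaseBlock, wp_seq]
  refine wp_order h.encodes h.labels h.zero fun τ hF hW hO => ?_
  have h1 := hF.reg 1 rfl
  have hA2 := hF.arr 2 rfl
  have hA3 := hF.arr 3 rfl
  have hE := h.encodes.frame hF rfl rfl
  have h0 := hE.1
  have hz : ∀ l ≥ n, τ.arr 4 l = 0 := fun l hl => by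
    by_contra hne
    exact ((hW l).1 hne).1.not_ge hl
  simp only [wp_cond, wp_seq, wp_const, wp_store, wp_copy, wp_skip, Test.Holds]
  set c := σ.arr 3 with hc
  refine ⟨fun hlt => ?_, fun hge => ?_⟩
  · obtain ⟨hl, hp, hne, hMA⟩ : Rep n c (τ.reg 2) ∧ Rep n c (τ.reg 3) ∧ τ.reg 3 ≠ τ.reg 2 ∧
        ∀ χ : ℕ → Prop, ¬ (χ (τ.reg 3) ↔ χ (τ.reg 2)) →
          linkWeight n N T c (fun l => Rep n c l ∧ l ≠ τ.reg 2) (τ.reg 2) ≤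
            weight (Finset.range n) (vertexWeight n T) (Splits (LabelEdge n N c) χ (Rep n c)) := by
      rcases hO.cases with ⟨-, -, e⟩ | ⟨hl, -, ⟨e, -⟩ | ⟨hp, hne, hMA⟩⟩
      · omega
      · omega
      · exact ⟨hl, hp, hne, hMA⟩
    refine wp_links (n := n) (N := N) (T := T) (by simpa [Encodes] using hE)
      (by simpa [hA3] using h.labels) fun τ₁ hF₁ h7 h5 => ?_
    -- With the mark of `last` erased, `linksBlock` measures the links of `last` to all other
    -- representatives.
    have hW' : (fun l => Function.update (τ.arr 4) (τ.reg 2) 0 l ≠ 0) =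
        fun l => Rep n c l ∧ l ≠ τ.reg 2 := by
      funext l
      by_cases hl : l = τ.reg 2
      · simp [hl]
      · simp [hl, ← hW]
    simp [-ne_eq, hA3, hW'] at h7 h5
    have hcut : τ₁.reg 7 = cutWeight n N T fun x => c x = τ.reg 2 := by
      rw [h7]
      exact weight_congr fun v _ => links_iff h.labels hl v
    have hX0 := nontrivial_rep h.labels hl hp hne
    replace h5 : ∀ v < n, τ₁.arr 5 v = if Separated n N T (fun x => c x = τ.reg 2) v
        then 1 else 0 := by
      intro v hv
      rw [h5 v hv, if_congr (links_iff h.labels hl v) rfl rfl]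
    have hG0 := hF₁.reg 0 rfl
    have hG1 := hF₁.reg 1 rfl
    have hG2 := hF₁.reg 2 rfl
    have hG3 := hF₁.reg 3 rfl
    have hB0 := hF₁.arr 0 rfl
    have hB2 := hF₁.arr 2 rfl
    have hB3 := hF₁.arr 3 rfl
    have hB4 := hF₁.arr 4 rfl
    simp at hG0 hG1 hG2 hG3 hB0 hB2 hB3 hB4
    rw [wp_seq]
    refine wp_update fun τ₂ hF₂ hU => ?_
    have hK0 := hF₂.reg 0 rfl
    have hK2 := hF₂.reg 2 rfl
    have hK3 := hF₂.reg 3 rfl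
    have hC0 := hF₂.arr 0 rfl
    have hC3 := hF₂.arr 3 rfl
    have hC4 := hF₂.arr 4 rfl
    refine wp_merge fun τ₃ hF₃ hM => ?_
    have hL0 := hF₃.reg 0 rfl
    have hL1 := hF₃.reg 1 rfl
    have hD0 := hF₃.arr 0 rfl
    have hD2 := hF₃.arr 2 rfl
    have hD4 := hF₃.arr 4 rfl
    rw [hK0, hG0, h0, hC3, hB3, hA3, hK2, hG2, hK3, hG3] at hM
    have hle : τ₃.reg 1 ≤ σ.reg 1 ∧ τ₃.reg 1 ≤ τ₁.reg 7 := by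
      rw [hL1, ← h1, ← hG1]
      rcases hU with ⟨e, hlt, -⟩ | ⟨e, hle, -⟩ <;> rw [e]
      · exact ⟨hlt.le, le_rfl⟩
      · exact ⟨le_rfl, hle⟩
    refine ⟨?_, h.labels.merge hl hp hne hM, ?_, hle.1.trans h.le, ?_, ?_, ?_⟩
    · rw [Encodes, hL0, hK0, hG0, hD0, hC0, hB0]
      exact hE
    · intro l hl
      rw [hD4, hC4, hB4, Function.update_apply, hz l hl, ite_self]
    · rw [hL1, hD2]
      rcases hU with ⟨e, hlt, hS⟩ | ⟨e, hle, hS⟩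
      · rw [e, hcut]
        refine hV _ _ hX0 ?_ fun v hv => ?_
        · rw [← hcut]
          exact hlt.trans_le ((hG1.trans h1).trans_le h.le)
        · rw [hS v (by rw [hG0, h0]; exact hv), h5 v hv]
      · rw [e, hS, hG1, h1, hB2, hA2]
        exact h.valid
    · intro X hX
      rcases h.respects X hX with hr | hr
      · exact .inl (hle.1.trans hr)
      · by_cases hχ : X (τ.reg 3) ↔ X (τ.reg 2)
        · exact .inr (hr.merge hχ hM)
        · refine .inl (hle.2.trans ?_)
          rw [h7]
          refine (hMA X hχ).trans (weight_mono fun v _ => (splits_iff h.labels hr v).1)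
    · refine (Nat.le_sub_one_of_lt ((Finset.card_lt_card ?_).trans_le h.card)).trans (by omega)
      refine (Finset.ssubset_iff_of_subset ?_).2 ⟨τ.reg 2, ?_, ?_⟩
      · intro u hu
        rw [Finset.mem_filter] at hu ⊢
        exact ⟨hu.1, (rep_merge hp hne hM hu.2).1⟩
      · exact Finset.mem_filter.2 ⟨Finset.mem_range.2 hl.1, hl⟩
      · intro hu
        exact (rep_merge hp hne hM (Finset.mem_filter.1 hu).2).2 rfl
  · refine ⟨hE, by rw [hA3]; exact h.labels, hz, by rw [h1]; exact h.le,
      by rw [h1, hA2]; exact h.valid, by rw [h1, hA3]; exact h.respects, ?_⟩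
    rw [hA3]
    -- If the ordering ends without a second to last vertex, there is at most one class and nothing
    -- remains to be merged.
    refine le_trans (Finset.card_le_one.2 fun u hu v hv => ?_) (le_max_left _ _)
    have hu := (Finset.mem_filter.1 hu).2
    have hv := (Finset.mem_filter.1 hv).2
    rcases hO.cases with ⟨h3, -⟩ | ⟨hl, -, ⟨-, h3⟩ | ⟨hp, -⟩⟩
    · exact absurd hu (h3 u)
    · rw [h3 u hu, h3 v hv]
    · exact absurd (h0 ▸ hp.1) hge

/-- Minimum cuts of the graph left by the vertex set `T` in array `1`: the best solution in
register `1` and array `2` is replaced by the set of separated vertices of a minimum cut if this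
set is smaller. -/
def minCutBlock : Block :=
  forN 22 (instr (.load 20 1 22) ⨾
    cond (.nonzero 20) (instr (.store 3 22 0)) (instr (.store 3 22 22))) ⨾
  forN 9 phaseBlock

open Classical in
theorem wp_minCut {Q : State → Prop} {V : ℕ → (ℕ → ℕ) → Prop} {σ : State} (hE : Encodes n N σ)
    (hz : ∀ l ≥ n, σ.arr 4 l = 0) (hT : ∀ x < n, σ.arr 1 x ≠ 0 ↔ T x)
    (hV₀ : V (σ.reg 1) (σ.arr 2))
    (hV : ∀ X a, Nontrivial n T X → cutWeight n N T X < σ.reg 1 →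
      (∀ v < n, a v = if Separated n N T X v then 1 else 0) → V (cutWeight n N T X) a)
    (hQ : ∀ τ, Frame minCutBlock σ τ → (∀ l ≥ n, τ.arr 4 l = 0) → τ.reg 1 ≤ σ.reg 1 →
      V (τ.reg 1) (τ.arr 2) → (∀ X, Nontrivial n T X → τ.reg 1 ≤ cutWeight n N T X) → Q τ) :
    wp minCutBlock Q σ := by
  refine wp_frame (wp_mono (Q := fun τ => (∀ l ≥ n, τ.arr 4 l = 0) ∧ τ.reg 1 ≤ σ.reg 1 ∧
      V (τ.reg 1) (τ.arr 2) ∧ (∀ X, Nontrivial n T X → τ.reg 1 ≤ cutWeight n N T X)) ?_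
    fun τ hF h _ => hQ τ hF h.1 h.2.1 h.2.2.1 h.2.2.2)
  have h0 := hE.1
  rw [minCutBlock, wp_seq]
  refine wp_forN (fun k τ => ∀ x < k, τ.arr 3 x = if T x then n else x) rfl (by simp) ?_ ?_
  · intro k τ hk hi hF hI
    have hF0 := hF.reg 0 rfl
    have hA1 := hF.arr 1 rfl
    have hTk := hT k (by omega)
    have hI' (a : ℕ) (x) (hx : x < k) :
        Function.update (τ.arr 3) k a x = if T x then n else x := by
      rw [Function.update_of_ne hx.ne, hI x hx]
    simp only [wp_seq, wp_load, wp_cond, Test.Holds, wp_store]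
    simp only [Nat.forall_lt_succ_right]
    simp [hi, hF0, hA1, h0]
    refine ⟨fun h => ⟨hI' _, fun hk => absurd (hTk.1 h) hk⟩, fun h => ⟨hI' _, fun hk => ?_⟩⟩
    exact absurd h (hTk.2 hk)
  · intro τ hF hI
    have h1 := hF.reg 1 rfl
    have hA2 := hF.arr 2 rfl
    have hA4 := hF.arr 4 rfl
    rw [h0] at hI
    have hE' := hE.frame hF rfl rfl
    have hb := hE'.1
    -- The bound falls from `n` to `0`. At the end at most one class is left, and no nontrivial cut
    -- respects it.
    refine wp_forN (fun k τ => CutInvariant n N T V (σ.reg 1) (n - k) τ) rfl ?_ ?_ ?_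
    · refine ⟨by simpa [Encodes] using hE', by simpa using labels_init hI, by simpa [hA4] using hz,
        by simp [h1], by simpa [h1, hA2] using hV₀, fun X _ => .inr ?_, ?_⟩
      · simpa using respects_init hI X
      · exact ((Finset.card_filter_le _ _).trans_eq (Finset.card_range n)).trans (le_max_right _ _)
    · intro k τ' hk hi hF' hI'
      refine wp_mono (wp_phase hV hI') fun τ'' _ h => ?_
      rw [Nat.sub_sub] at h
      exact ⟨by simpa [Encodes] using h.encodes, by simpa using h.labels, by simpa using h.zero,
        by simpa using h.le, by simpa using h.valid, by simpa using h.respects,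
        by rw [State.setReg_arr]; exact h.card⟩
    · intro τ' _ h
      refine ⟨h.zero, h.le, h.valid, fun X hX => (h.respects X hX).resolve_right fun hr => ?_⟩
      have hcard := h.card
      rw [hb, Nat.sub_self, max_eq_left zero_le_one, Finset.card_le_one] at hcard
      exact not_nontrivial h.labels hr (fun u v hu hv => hcard u (by simp [hu, hu.1]) v
        (by simp [hv, hv.1])) hX

end CutAlgorithm

/-! ### Independent cutsets and partitions -/

namespace SimpleGraph

variable {V : Type*} {G : SimpleGraph V}

/-- The closed neighborhood of `v` contains vertices outside of `T` on both sides of the partition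
defined by `X`. -/
def Separates (G : SimpleGraph V) (T X : Set V) (v : V) : Prop :=
  (∃ a, (v = a ∨ G.Adj v a) ∧ a ∉ T ∧ a ∈ X) ∧ ∃ a, (v = a ∨ G.Adj v a) ∧ a ∉ T ∧ a ∉ X

/-- The side `X` extends to the vertices of `T` outside of `F`: such a vertex is not separated, so
its neighbors all lie on one side. No edge of `G - F` then joins the two sides. -/
theorem isCutset_of_separates {T X : Set V} (hT : G.IsIndepSet T) (ha : ∃ a ∉ T, a ∈ X)
    (hb : ∃ b ∉ T, b ∉ X) {F : Finset V} (hFT : (F : Set V) ⊆ T)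
    (hF : ∀ v, G.Separates T X v → v ∈ F) : G.IsCutset F := by
  obtain ⟨a, haT, haX⟩ := ha
  obtain ⟨b, hbT, hbX⟩ := hb
  intro hconn
  -- A vertex of `T` is put on the side of `X` as soon as one neighbor is there; by independence of
  -- `T`, all its neighbors are outside of `T`.
  let Y : Set V := {w | (w ∉ T ∧ w ∈ X) ∨ w ∈ T ∧ ∃ a, G.Adj w a ∧ a ∉ T ∧ a ∈ X}
  have step : ∀ u w : ((F : Set V)ᶜ : Set V), G.Adj u.1 w.1 → u.1 ∈ Y → w.1 ∈ Y := by
    rintro ⟨u, hu⟩ ⟨w, hw⟩ huw hY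
    simp only at huw hY ⊢
    by_cases hwT : w ∈ T
    · rcases hY with ⟨huT, huX⟩ | ⟨huT, -⟩
      · exact .inr ⟨hwT, u, huw.symm, huT, huX⟩
      · exact absurd huw (hT huT hwT huw.ne)
    · refine .inl ⟨hwT, by_contra fun hwX => ?_⟩
      rcases hY with ⟨huT, huX⟩ | ⟨-, c, huc, hcT, hcX⟩
      · exact hu (hF u ⟨⟨u, .inl rfl, huT, huX⟩, w, .inr huw, hwT, hwX⟩)
      · exact hu (hF u ⟨⟨c, .inr huc, hcT, hcX⟩, w, .inr huw, hwT, hwX⟩)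
  obtain ⟨p⟩ := hconn ⟨a, fun h => haT (hFT h)⟩ ⟨b, fun h => hbT (hFT h)⟩
  have walk : ∀ {u w : ((F : Set V)ᶜ : Set V)}, (G.induce ((F : Set V)ᶜ)).Walk u w →
      u.1 ∈ Y → w.1 ∈ Y := by
    intro u w q
    induction q with
    | nil => exact id
    | cons h _ ih => exact fun hu => ih (step _ _ h hu)
  rcases walk p (.inl ⟨haT, haX⟩) with ⟨-, h⟩ | ⟨h, -⟩
  exacts [hbX h, hbT h]

/-- Take for `X` one component of `G - S`. A vertex outside of `S` lies in the same component as its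
neighbors outside of `S`, so it cannot be separated. -/
theorem IsCutset.exists_separates (hG : G.Connected) {T : Set V} (hT : G.IsIndepSet T)
    {S : Finset V} (hST : (S : Set V) ⊆ T) (hS : G.IsCutset S) :
    ∃ X : Set V, (∃ a ∉ T, a ∈ X) ∧ (∃ b ∉ T, b ∉ X) ∧ ∀ v, G.Separates T X v → v ∈ S := by
  simp only [IsCutset, Preconnected, not_forall] at hS
  obtain ⟨x, y, hxy⟩ := hS
  have : Nontrivial V := ⟨x.1, y.1, fun h => hxy (by rw [Subtype.ext h])⟩
  -- Both sides must contain vertices outside of `T`. A vertex of `T` has a neighbor by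
  -- connectedness, and this neighbor is not in `T` by independence.
  have out : ∀ z : ((S : Set V)ᶜ : Set V), ∃ a : ((S : Set V)ᶜ : Set V), a.1 ∉ T ∧
      (G.induce ((S : Set V)ᶜ)).Reachable z a := by
    intro z
    by_cases hz : z.1 ∈ T
    · obtain ⟨a, ha⟩ := hG.preconnected.exists_adj_of_nontrivial z.1
      have haT : a ∉ T := fun h => hT hz h ha.ne ha
      have hadj : (G.induce ((S : Set V)ᶜ)).Adj z ⟨a, fun h => haT (hST h)⟩ := ha
      exact ⟨_, haT, hadj.reachable⟩
    · exact ⟨z, hz, .refl z⟩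
  obtain ⟨a, haT, ha⟩ := out x
  obtain ⟨b, hbT, hb⟩ := out y
  refine ⟨{w | ∃ h : w ∉ S, (G.induce ((S : Set V)ᶜ)).Reachable x ⟨w, h⟩}, ⟨a, haT, a.2, ha⟩,
    ⟨b, hbT, fun ⟨_, h⟩ => hxy (h.trans hb.symm)⟩, ?_⟩
  rintro v ⟨⟨c, hvc, hcT, hcS, hc⟩, ⟨d, hvd, hdT, hd⟩⟩
  by_contra hv
  have near : ∀ e (he : e ∉ S), v = e ∨ G.Adj v e →
      (G.induce ((S : Set V)ᶜ)).Reachable ⟨v, hv⟩ ⟨e, he⟩ := by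
    rintro e he (rfl | h)
    · exact .refl _
    · have hadj : (G.induce ((S : Set V)ᶜ)).Adj ⟨v, hv⟩ ⟨e, he⟩ := h
      exact hadj.reachable
  have hdS : d ∉ S := fun h => hdT (hST h)
  exact hd ⟨hdS, hc.trans ((near c hcS hvc).symm.trans (near d hdS hvd))⟩

/-- Edge cuts of the auxiliary hypergraph are independent cutsets. -/
theorem isIndepCutset_of_isEdgeCut {S' : Finset V} (hS' : G.IsIndepSet (S' : Set V))
    {F : Finset {v // v ∈ S'}} (hF : (G.cutHypergraph S').IsEdgeCut F) :
    G.IsIndepCutset (F.map (Function.Embedding.subtype _)) := by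
  obtain ⟨X, ⟨K, hK⟩, ⟨L, hL⟩, hX⟩ := hF
  have hsub : ((F.map (Function.Embedding.subtype _) : Finset V) : Set V) ⊆ S' := by
    intro v hv
    obtain ⟨u, -, rfl⟩ := Finset.mem_map.1 hv
    exact u.2
  let Y : Set V := {w | ∃ h : w ∉ S', (G.induce ((S' : Set V)ᶜ)).connectedComponentMk ⟨w, h⟩ ∈ X}
  refine ⟨hS'.mono hsub, isCutset_of_separates (X := Y) hS' ?_ ?_ hsub ?_⟩
  · obtain ⟨⟨a, ha⟩, rfl⟩ := K.exists_rep
    exact ⟨a, ha, ha, hK⟩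
  · obtain ⟨⟨b, hb⟩, rfl⟩ := L.exists_rep
    exact ⟨b, hb, fun ⟨_, h⟩ => hL h⟩
  · rintro v ⟨⟨a, hva, haT, haS, ha⟩, ⟨b, hvb, hbT, hb⟩⟩
    replace hb : (G.induce ((S' : Set V)ᶜ)).connectedComponentMk ⟨b, hbT⟩ ∉ X :=
      fun h => hb ⟨hbT, h⟩
    by_cases hv : v ∈ S'
    · have adj : ∀ c ∉ S', v = c ∨ G.Adj v c → G.Adj v c := by
        rintro c hc (rfl | h)
        exacts [absurd hv hc, h]
      refine Finset.mem_map.2 ⟨⟨v, hv⟩, (hX ⟨v, hv⟩).2 ⟨⟨_, ?_, ha⟩, ⟨_, ?_, hb⟩⟩, rfl⟩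
      · exact ⟨_, rfl, adj a haS hva⟩
      · exact ⟨_, rfl, adj b hbT hvb⟩
    · have near : ∀ c (hc : c ∉ S'), v = c ∨ G.Adj v c →
          (G.induce ((S' : Set V)ᶜ)).connectedComponentMk ⟨v, hv⟩ =
            (G.induce ((S' : Set V)ᶜ)).connectedComponentMk ⟨c, hc⟩ := by
        rintro c hc (rfl | h)
        · rfl
        · have hadj : (G.induce ((S' : Set V)ᶜ)).Adj ⟨v, hv⟩ ⟨c, hc⟩ := h
          exact ConnectedComponent.sound hadj.reachable
      refine absurd ?_ hb
      rwa [← near b hbT hvb, near a haS hva]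

/-- Each independent cutset in `S'` contains an edge cut of the auxiliary hypergraph. -/
theorem IsIndepCutset.exists_isEdgeCut (hG : G.Connected) {S' S : Finset V}
    (hS' : G.IsIndepSet (S' : Set V)) (hSS' : S ⊆ S') (hS : G.IsIndepCutset S) :
    ∃ F : Finset {v // v ∈ S'}, (G.cutHypergraph S').IsEdgeCut F ∧
      F.map (Function.Embedding.subtype _) ⊆ S := by
  classical
  obtain ⟨Y, ⟨a, haT, haY⟩, ⟨b, hbT, hbY⟩, hY⟩ :=
    hS.2.exists_separates hG hS' (Finset.coe_subset.2 hSS')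
  -- Vertices outside of `S'` are not in `S` and hence not separated, so `Y` is constant on each
  -- component of `G - S'` and one vertex decides for its component.
  let X : Set (G.induce ((S' : Set V)ᶜ)).ConnectedComponent :=
    {K | ∃ w : ((S' : Set V)ᶜ : Set V),
      (G.induce ((S' : Set V)ᶜ)).connectedComponentMk w = K ∧ w.1 ∈ Y}
  have walk : ∀ {u w : ((S' : Set V)ᶜ : Set V)}, (G.induce ((S' : Set V)ᶜ)).Walk u w →
      u.1 ∈ Y → w.1 ∈ Y := by
    intro u w q
    induction q with
    | nil => exact id
    | @cons u v w h _ ih =>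
      refine fun hu => ih (by_contra fun hv => u.2 (hSS' (hY u.1 ⟨?_, ?_⟩)))
      · exact ⟨u.1, .inl rfl, u.2, hu⟩
      · exact ⟨v.1, .inr h, v.2, hv⟩
  have hXY : ∀ w : ((S' : Set V)ᶜ : Set V),
      (G.induce ((S' : Set V)ᶜ)).connectedComponentMk w ∈ X → w.1 ∈ Y := by
    rintro w ⟨u, hu, huY⟩
    obtain ⟨q⟩ := ConnectedComponent.exact hu
    exact walk q huY
  refine ⟨S'.attach.filter fun e => (((G.cutHypergraph S').edge e ∩ X).Nonempty ∧
      ((G.cutHypergraph S').edge e ∩ Xᶜ).Nonempty), ⟨X, ?_, ?_, ?_⟩, ?_⟩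
  · exact ⟨_, ⟨a, haT⟩, rfl, haY⟩
  · exact ⟨(G.induce ((S' : Set V)ᶜ)).connectedComponentMk ⟨b, hbT⟩, fun h => hbY (hXY _ h)⟩
  · intro e
    simp
  · intro v hv
    obtain ⟨e, he, rfl⟩ := Finset.mem_map.1 hv
    obtain ⟨⟨_, ⟨c, rfl, hc⟩, hcX⟩, ⟨_, ⟨d, rfl, hd⟩, hdX⟩⟩ := (Finset.mem_filter.1 he).2
    exact hY _ ⟨⟨c.1, .inr hc, c.2, hXY _ hcX⟩, ⟨d.1, .inr hd, d.2, fun h => hdX ⟨d, rfl, h⟩⟩⟩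

/-- An independent cutset inside `S'` need not be an edge cut, but it contains one, and edge cuts
are independent cutsets. So the minimum sizes agree, and a smallest cutset equals the edge cut that
it contains. -/
theorem isMinimumEdgeCut_iff (hG : G.Connected) {S' : Finset V} (hS' : G.IsIndepSet (S' : Set V))
    (F : Finset {v // v ∈ S'}) :
    (G.cutHypergraph S').IsMinimumEdgeCut F ↔
      G.IsSmallestIndepCutsetIn S' (F.map (Function.Embedding.subtype _)) := by
  have hsub (F : Finset {v // v ∈ S'}) : F.map (Function.Embedding.subtype _) ⊆ S' := by
    intro v hv
    obtain ⟨u, -, rfl⟩ := Finset.mem_map.1 hv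
    exact u.2
  constructor
  · rintro ⟨hF, hmin⟩
    refine ⟨hsub F, isIndepCutset_of_isEdgeCut hS' hF, fun R hRS' hR => ?_⟩
    obtain ⟨F', hF', hle⟩ := hR.exists_isEdgeCut hG hS' hRS'
    rw [Finset.card_map]
    exact (hmin F' hF').trans ((Finset.card_map _).symm.trans_le (Finset.card_le_card hle))
  · rintro ⟨-, hF, hmin⟩
    have hmin' : ∀ F', (G.cutHypergraph S').IsEdgeCut F' → F.card ≤ F'.card := fun F' hF' => by
      simpa using hmin _ (hsub F') (isIndepCutset_of_isEdgeCut hS' hF')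
    obtain ⟨F', hF', hle⟩ := hF.exists_isEdgeCut hG hS' (hsub F)
    have : F' = F := Finset.eq_of_subset_of_card_le (Finset.map_subset_map.1 hle) (hmin' F' hF')
    exact ⟨this ▸ hF', hmin'⟩

end SimpleGraph

/-! ### Weighted cuts of the closed neighborhoods versus independent cutsets -/

namespace CutAlgorithm

variable {n : ℕ} {G : SimpleGraph (Fin n)}

/-- The closed neighborhoods of a graph on `Fin n` as a relation between numbers. -/
def closedNbr (G : SimpleGraph (Fin n)) (v x : ℕ) : Prop :=
  ∃ i j : Fin n, (i = j ∨ G.Adj i j) ∧ i.val = v ∧ j.val = x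

theorem closedNbr_coe {i j : Fin n} : closedNbr G i j ↔ i = j ∨ G.Adj i j := by
  constructor
  · rintro ⟨k, l, h, hk, hl⟩
    rwa [← Fin.ext hk, ← Fin.ext hl]
  · exact fun h => ⟨i, j, h, rfl, rfl⟩

theorem separated_coe {T X : ℕ → Prop} {i : Fin n} :
    Separated n (closedNbr G) T X i ↔
      G.Separates {j : Fin n | T j} {j : Fin n | X j} i := by
  simp only [Separated, SimpleGraph.Separates, Fin.exists_iff, Set.mem_ofPred_eq, ← closedNbr_coe,
    exists_prop]

theorem nontrivial_iff {T X : ℕ → Prop} :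
    Nontrivial n T X ↔ (∃ a ∉ {j : Fin n | T j}, a ∈ {j : Fin n | X j}) ∧
      ∃ a ∉ {j : Fin n | T j}, a ∉ {j : Fin n | X j} := by
  simp only [Nontrivial, Fin.exists_iff, Set.mem_ofPred_eq, exists_prop]

open Classical in
/-- The separated vertices as a set of vertices of the graph. -/
noncomputable def cutFinset (G : SimpleGraph (Fin n)) (T X : ℕ → Prop) : Finset (Fin n) :=
  Finset.univ.filter fun i => Separated n (closedNbr G) T X i

theorem mem_cutFinset {T X : ℕ → Prop} {i : Fin n} :
    i ∈ cutFinset G T X ↔ Separated n (closedNbr G) T X i := by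
  simp [cutFinset]

theorem cutWeight_eq_sum (T X : ℕ → Prop) :
    cutWeight n (closedNbr G) T X = ∑ i ∈ cutFinset G T X, vertexWeight n T i := by
  classical
  rw [cutWeight, weight, cutFinset, Finset.sum_filter, Finset.sum_filter, Finset.sum_range]

/-- One separated vertex outside of `T` would already contribute `n` to the weight. Hence only
vertices of weight one are separated, and the weight counts them. -/
theorem cutFinset_spec {T X : ℕ → Prop} (hT : G.IsIndepSet {j : Fin n | T j})
    (hX : Nontrivial n T X) (hlt : cutWeight n (closedNbr G) T X < n) :
    (∀ i ∈ cutFinset G T X, T i) ∧ G.IsIndepCutset (cutFinset G T X) ∧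
      (cutFinset G T X).card = cutWeight n (closedNbr G) T X := by
  have hsub : ∀ i ∈ cutFinset G T X, T i := by
    intro i hi
    by_contra hTi
    rw [cutWeight_eq_sum] at hlt
    refine hlt.not_ge (le_trans ?_ (Finset.single_le_sum (fun _ _ => Nat.zero_le _) hi))
    simp [vertexWeight, hTi]
  rw [nontrivial_iff] at hX
  refine ⟨hsub, ⟨hT.mono hsub, ?_⟩, ?_⟩
  · exact SimpleGraph.isCutset_of_separates hT hX.1 hX.2 hsub fun v hv =>
      mem_cutFinset.2 (separated_coe.2 hv)
  · rw [cutWeight_eq_sum, Finset.card_eq_sum_ones]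
    exact Finset.sum_congr rfl fun i hi => by simp [vertexWeight, hsub i hi]

theorem exists_cutWeight_le (hG : G.Connected) {T : ℕ → Prop}
    (hT : G.IsIndepSet {j : Fin n | T j}) {S : Finset (Fin n)} (hST : ∀ i ∈ S, T i)
    (hS : G.IsCutset S) :
    ∃ X, Nontrivial n T X ∧ cutWeight n (closedNbr G) T X ≤ S.card := by
  obtain ⟨Y, h1, h2, hY⟩ := hS.exists_separates hG hT hST
  have hYY : {j : Fin n | ∃ i ∈ Y, i.val = j.val} = Y := by
    ext j
    exact ⟨fun ⟨i, hi, e⟩ => Fin.ext e ▸ hi, fun h => ⟨j, h, rfl⟩⟩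
  refine ⟨fun x => ∃ i ∈ Y, i.val = x, nontrivial_iff.2 (by rw [hYY]; exact ⟨h1, h2⟩), ?_⟩
  have hsub : cutFinset G T (fun x => ∃ i ∈ Y, i.val = x) ⊆ S := by
    intro i hi
    rw [mem_cutFinset, separated_coe, hYY] at hi
    exact hY i hi
  rw [cutWeight_eq_sum]
  refine le_trans (le_of_eq ?_) (Finset.card_le_card hsub)
  rw [Finset.card_eq_sum_ones]
  exact Finset.sum_congr rfl fun i hi => by simp [vertexWeight, hST i (hsub hi)]

end CutAlgorithm

/-! ### The program for a smallest cutset inside a given one -/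

namespace CutAlgorithm

open RAM RAM.Block

variable {n : ℕ} {G : SimpleGraph (Fin n)}

theorem graphArray_ne_zero_iff {i j : Fin n} : graphArray G (i * n + j) ≠ 0 ↔ G.Adj i j := by
  have hdiv (a b : Fin n) : (a.val * n + b.val) / n = a ∧ (a.val * n + b.val) % n = b := by
    have hn : 0 < n := a.pos
    rw [mul_comm, Nat.mul_add_div hn, Nat.mul_add_mod, Nat.div_eq_of_lt b.2, Nat.mod_eq_of_lt b.2]
    simp
  simp only [graphArray, ne_eq, ite_eq_right_iff, Classical.not_imp, one_ne_zero, not_false_eq_true, and_true]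
  constructor
  · rintro ⟨k, l, h, e⟩
    have h1 := (hdiv i j).1
    have h2 := (hdiv i j).2
    rw [e, (hdiv k l).1] at h1
    rw [e, (hdiv k l).2] at h2
    rwa [← Fin.ext h1, ← Fin.ext h2]
  · exact fun h => ⟨i, j, h, rfl⟩

theorem encodes_of_graphArray {σ : State} (h0 : σ.reg 0 = n) (hA : σ.arr 0 = graphArray G) :
    Encodes n (closedNbr G) σ := by
  refine ⟨h0, fun v hv x hx => ?_⟩
  lift v to Fin n using hv
  lift x to Fin n using hx
  rw [hA, graphArray_ne_zero_iff, closedNbr_coe, Fin.ext_iff, or_comm]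

theorem setArray_ne_zero_iff {S : Finset (Fin n)} {x : ℕ} :
    setArray S x ≠ 0 ↔ ∃ i ∈ S, x = i.val := by
  simp [setArray]

/-- Makes `n` usable as the size that signals that no cutset has been found. -/
theorem card_lt_of_isCutset {S : Finset (Fin n)} (hS : G.IsCutset S) : S.card < n := by
  refine (Finset.card_lt_univ_of_notMem (x := ?_) ?_).trans_eq (Fintype.card_fin n)
  all_goals
    simp only [SimpleGraph.IsCutset, SimpleGraph.Preconnected, not_forall] at hS
  · exact hS.choose.1
  · exact hS.choose.2

/-- The block that finds a smallest independent cutset inside a given one. -/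
def smallestCutsetBlock : Block := instr (.copy 1 0) ⨾ minCutBlock

theorem exists_program_smallest :
    ∃ (P : RAM.Program) (p : Polynomial ℕ),
      ∀ (n : ℕ) (G : SimpleGraph (Fin n)), G.Connected →
        ∀ S' : Finset (Fin n), G.IsIndepCutset S' →
        RAM.HaltsWithin P (RAM.graphSetInput G S') (p.eval n) fun σ =>
          ∃ S : Finset (Fin n), RAM.Outputs σ S ∧ G.IsSmallestIndepCutsetIn S' S := by
  classical
  refine ⟨smallestCutsetBlock.compile, smallestCutsetBlock.cost, fun n G hG S' hS' => ?_⟩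
  have h0 : (graphSetInput G S').reg 0 = n := by simp [graphSetInput, graphInput]
  have hz : ∀ a > 1, ∀ x, (graphSetInput G S').arr a x = 0 := by
    intro a ha x
    simp [graphSetInput, graphInput, show a ≠ 1 by omega, show a ≠ 0 by omega]
  have hset : {j : Fin n | ∃ i ∈ S', j.val = i.val} = (S' : Set (Fin n)) := by
    ext j
    exact ⟨fun ⟨i, hi, e⟩ => Fin.ext e ▸ hi, fun h => ⟨j, h, rfl⟩⟩
  have hind : G.IsIndepSet {j : Fin n | ∃ i ∈ S', j.val = i.val} := by rw [hset]; exact hS'.1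
  have := haltsWithin_compile (p := smallestCutsetBlock) (σ := graphSetInput G S')
    (Q := fun σ => ∃ S : Finset (Fin n), RAM.Outputs σ S ∧ G.IsSmallestIndepCutsetIn S' S)
    (by decide) (by decide) ?_
  · rwa [h0] at this
  simp only [smallestCutsetBlock, wp_seq, wp_copy]
  refine wp_minCut (n := n) (N := closedNbr G) (T := fun x => ∃ i ∈ S', x = i.val)
    -- The first alternative describes the start. It is excluded at the end because `S'` is itself a
    -- cutset with fewer than `n` vertices.
    (V := fun b a => b = n ∨ ∃ F ⊆ S', G.IsIndepCutset F ∧ F.card = b ∧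
      ∀ i : Fin n, a i = if i ∈ F then 1 else 0) ?_ ?_ ?_ (by simp [h0]) ?_ ?_
  · exact encodes_of_graphArray (by simp [h0]) (by simp [graphSetInput, graphInput])
  · simp [hz 4]
  · intro x _
    simp [graphSetInput, ← setArray_ne_zero_iff]
  · intro X a hX hlt ha
    simp [h0] at hlt
    obtain ⟨hsub, hF, hcard⟩ := cutFinset_spec hind hX hlt
    refine .inr ⟨cutFinset G _ X, fun i hi => ?_, hF, hcard, fun i => ?_⟩
    · exact hset.subset (hsub i hi)
    · rw [ha i i.2, if_congr mem_cutFinset rfl rfl]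
  · intro τ _ _ _ hV hle
    have hle' : ∀ R ⊆ S', G.IsIndepCutset R → τ.reg 1 ≤ R.card := by
      intro R hR hRc
      obtain ⟨X, hX, hXc⟩ := exists_cutWeight_le
        (T := fun x => ∃ i ∈ S', x = i.val) hG hind (fun i hi => ⟨i, hR hi, rfl⟩) hRc.2
      exact (hle X hX).trans hXc
    rcases hV with hV | ⟨F, hFS, hF, hcard, hout⟩
    · have := hle' S' subset_rfl hS'
      have := card_lt_of_isCutset hS'.2
      omega
    · exact ⟨F, hout, hFS, hF, fun R hR hRc => hcard.trans_le (hle' R hR hRc)⟩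

end CutAlgorithm

/-! ### Enumeration of the maximal independent sets -/

namespace CutAlgorithm

section Branching

/-- The independent sets are those without two distinct elements related by `N`. -/
def Indep (N : ℕ → ℕ → Prop) (I : Finset ℕ) : Prop := ∀ x ∈ I, ∀ y ∈ I, N x y → x = y

/-- The maximal independent sets. -/
structure MaxIndep (n : ℕ) (N : ℕ → ℕ → Prop) (M : Finset ℕ) : Prop where
  lt : ∀ x ∈ M, x < n
  indep : Indep N M
  dominates : ∀ x < n, ∃ y ∈ M, N x y

open Classical in
/-- The vertices outside of the closed neighborhood of `I`. -/
noncomputable def alive (n : ℕ) (N : ℕ → ℕ → Prop) (I : Finset ℕ) : Finset ℕ :=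
  (Finset.range n).filter fun x => ∀ y ∈ I, ¬ N x y

open Classical in
/-- The alive vertices in the closed neighborhood of `v`. -/
noncomputable def aliveNbrs (n : ℕ) (N : ℕ → ℕ → Prop) (I : Finset ℕ) (v : ℕ) : Finset ℕ :=
  (alive n N I).filter fun x => N v x

open Classical in
/-- The independent sets that arise from `I` by adding an alive vertex `w < k` from the closed
neighborhood of `v`. -/
noncomputable def children (n : ℕ) (N : ℕ → ℕ → Prop) (I : Finset ℕ) (v k : ℕ) :
    List (Finset ℕ) :=
  ((List.range k).filter fun w => w ∈ aliveNbrs n N I v).map fun w => insert w I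

/-- A bound for the number of nodes in the branching tree of a graph with `m` vertices. -/
noncomputable def potential (m : ℕ) : ℝ := (m + 1) * 3 ^ ((m : ℝ) / 3)

/-- The total potential of a list of independent sets. -/
noncomputable def totalPotential (n : ℕ) (N : ℕ → ℕ → Prop) (L : List (Finset ℕ)) : ℝ :=
  (L.map fun I => potential (alive n N I).card).sum

variable {n : ℕ} {N : ℕ → ℕ → Prop} {I M : Finset ℕ}

theorem mem_alive {x : ℕ} : x ∈ alive n N I ↔ x < n ∧ ∀ y ∈ I, ¬ N x y := by
  simp [alive]

theorem mem_aliveNbrs {v x : ℕ} : x ∈ aliveNbrs n N I v ↔ x ∈ alive n N I ∧ N v x := by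
  simp [aliveNbrs]

open Classical in
theorem children_succ (v k : ℕ) : children n N I v (k + 1) =
    children n N I v k ++ if k ∈ aliveNbrs n N I v then [insert k I] else [] := by
  rw [children, List.range_succ, List.filter_append, List.map_append, ← children]
  split_ifs with h <;> simp [h]

theorem mem_children {v : ℕ} {J : Finset ℕ} :
    J ∈ children n N I v n ↔ ∃ w ∈ aliveNbrs n N I v, J = insert w I := by
  simp only [children, List.mem_map, List.mem_filter, List.mem_range, decide_eq_true_eq]
  constructor
  · rintro ⟨w, ⟨-, h⟩, rfl⟩
    exact ⟨w, h, rfl⟩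
  · rintro ⟨w, h, rfl⟩
    exact ⟨w, ⟨(mem_alive.1 (mem_aliveNbrs.1 h).1).1, h⟩, rfl⟩

/-- Amounts to `s ^ 3 ≤ 3 ^ s`, with equality for `s = 3`; this is the origin of the base `3^(1/3)`.
-/
theorem natCast_le_three_rpow (s : ℕ) : (s : ℝ) ≤ 3 ^ ((s : ℝ) / 3) := by
  have hnat : s ^ 3 ≤ 3 ^ s := by
    rcases lt_or_ge s 3 with h | h
    · interval_cases s <;> norm_num
    · induction s, h using Nat.le_induction with
      | base => norm_num
      | succ k hk ih =>
        rw [pow_succ 3 k]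
        nlinarith [Nat.mul_le_mul hk hk, Nat.mul_le_mul hk (Nat.mul_le_mul hk hk)]
  refine le_of_pow_le_pow_left₀ (three_ne_zero) (by positivity) ?_
  rw [← Real.rpow_natCast (3 ^ ((s : ℝ) / 3)), ← Real.rpow_mul (by norm_num)]
  rw [show (s : ℝ) / 3 * (3 : ℕ) = s by push_cast; ring, Real.rpow_natCast]
  exact_mod_cast hnat

theorem potential_mono {a b : ℕ} (h : a ≤ b) : potential a ≤ potential b := by
  have h' : (a : ℝ) ≤ b := by exact_mod_cast h
  unfold potential
  gcongr
  norm_num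

theorem potential_nonneg (m : ℕ) : 0 ≤ potential m := by
  unfold potential
  positivity

/-- The exponential factor alone only balances the children against their parent. The factor `m + 1`
drops to at most `m`, which frees `3^(m/3) ≥ 1` to pay for the step. -/
theorem mul_potential_le {s m : ℕ} (hs : 1 ≤ s) (hsm : s ≤ m) :
    s * potential (m - s) ≤ potential m - 1 := by
  unfold potential
  rw [Nat.cast_sub hsm]
  have h1 := natCast_le_three_rpow s
  have h2 : (3 : ℝ) ^ ((m : ℝ) / 3) = 3 ^ ((s : ℝ) / 3) * 3 ^ (((m : ℝ) - s) / 3) := by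
    rw [← Real.rpow_add (by norm_num)]
    ring_nf
  have h3 : (1 : ℝ) ≤ 3 ^ ((m : ℝ) / 3) := Real.one_le_rpow (by norm_num) (by positivity)
  have h4 : (1 : ℝ) ≤ s := by exact_mod_cast hs
  have h5 : (s : ℝ) ≤ m := by exact_mod_cast hsm
  have h6 : (0 : ℝ) < 3 ^ (((m : ℝ) - s) / 3) := by positivity
  have h7 : (s : ℝ) * 3 ^ (((m : ℝ) - s) / 3) ≤ 3 ^ ((m : ℝ) / 3) := by
    rw [h2]
    gcongr
  have h8 : ((m : ℝ) - s + 1) * (s * 3 ^ (((m : ℝ) - s) / 3)) ≤ m * 3 ^ ((m : ℝ) / 3) :=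
    mul_le_mul (by linarith) h7 (by positivity) (by linarith)
  linarith

theorem sum_map_filter_range (p : ℕ → Prop) [DecidablePred p] (f : ℕ → ℝ) (k : ℕ) :
    (((List.range k).filter fun w => p w).map f).sum = ∑ w ∈ Finset.range k with p w, f w := by
  induction k with
  | zero => simp
  | succ k ih =>
    rw [List.range_succ, List.filter_append, List.map_append, List.sum_append, ih,
      Finset.sum_filter, Finset.sum_filter, Finset.sum_range_succ]
    by_cases h : p k <;> simp [h]

/-- Of the `s` children, the one that adds `w` loses the closed alive neighborhood of `w`, which has
at least `s` vertices by the choice of `v`. -/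
theorem totalPotential_children_le (hrefl : ∀ x < n, N x x) (hsymm : ∀ x y, N x y → N y x) {v : ℕ}
    (hv : v ∈ alive n N I)
    (hmin : ∀ u ∈ alive n N I, (aliveNbrs n N I v).card ≤ (aliveNbrs n N I u).card) :
    totalPotential n N (children n N I v n) ≤ potential (alive n N I).card - 1 := by
  classical
  set m := (alive n N I).card
  set s := (aliveNbrs n N I v).card
  have hs : 1 ≤ s := Finset.card_pos.2 ⟨v, mem_aliveNbrs.2 ⟨hv, hrefl v (mem_alive.1 hv).1⟩⟩
  have hsm : s ≤ m := Finset.card_filter_le _ _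
  refine le_trans ?_ (mul_potential_le hs hsm)
  rw [totalPotential, children, List.map_map, sum_map_filter_range, ← nsmul_eq_mul]
  have hset : (Finset.range n).filter (fun w => w ∈ aliveNbrs n N I v) = aliveNbrs n N I v := by
    ext w
    simp only [Finset.mem_filter, Finset.mem_range, and_iff_right_iff_imp]
    exact fun h => (mem_alive.1 (mem_aliveNbrs.1 h).1).1
  rw [hset]
  refine Finset.sum_le_card_nsmul _ _ _ fun w hw => potential_mono ?_
  have hw' := (mem_aliveNbrs.1 hw).1
  have hsub : alive n N (insert w I) ⊆ alive n N I \ aliveNbrs n N I w := by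
    intro x hx
    rw [mem_alive] at hx
    rw [Finset.mem_sdiff, mem_aliveNbrs]
    exact ⟨mem_alive.2 ⟨hx.1, fun y hy => hx.2 y (Finset.mem_insert_of_mem hy)⟩,
      fun h => hx.2 w (Finset.mem_insert_self _ _) (hsymm _ _ h.2)⟩
  refine (Finset.card_le_card hsub).trans ?_
  rw [Finset.card_sdiff_of_subset (show aliveNbrs n N I w ⊆ _ from Finset.filter_subset _ _)]
  exact Nat.sub_le_sub_left (hmin w hw') m

theorem Indep.insert (hsymm : ∀ x y, N x y → N y x) (hI : Indep N I) {w : ℕ}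
    (hw : w ∈ alive n N I) : Indep N (insert w I) := by
  have hw' := (mem_alive.1 hw).2
  intro x hx y hy h
  rcases Finset.mem_insert.1 hx with hx' | hx' <;> rcases Finset.mem_insert.1 hy with hy' | hy'
  · rw [hx', hy']
  · exact absurd (hx' ▸ h) (hw' y hy')
  · exact absurd (hsymm _ _ (hy' ▸ h)) (hw' x hx')
  · exact hI x hx' y hy' h

theorem exists_maxIndep (hrefl : ∀ x < n, N x x) (hsymm : ∀ x y, N x y → N y x)
    (hn : ∀ x ∈ I, x < n) (hI : Indep N I) : ∃ M, I ⊆ M ∧ MaxIndep n N M := by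
  have hfin : {M : Finset ℕ | (∀ x ∈ M, x < n) ∧ Indep N M}.Finite :=
    (Finset.range n).powerset.finite_toSet.subset fun M hM =>
      Finset.mem_coe.2 (Finset.mem_powerset.2 fun x hx => Finset.mem_range.2 (hM.1 x hx))
  obtain ⟨M, hIM, hM⟩ := hfin.exists_le_maximal (a := I) ⟨hn, hI⟩
  refine ⟨M, hIM, hM.prop.1, hM.prop.2, fun x hx => ?_⟩
  by_contra! hdom
  have hmem : x ∈ alive n N M := mem_alive.2 ⟨hx, hdom⟩
  have hins := hM.le_of_ge (y := insert x M)
    ⟨fun y hy => (Finset.mem_insert.1 hy).elim (fun e => e ▸ hx) (hM.prop.1 y),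
      hM.prop.2.insert hsymm hmem⟩ (Finset.subset_insert _ _)
  exact hdom x (hins (Finset.mem_insert_self _ _)) (hrefl x hx)

/-- A maximal independent set dominates `v`. The dominating vertex is alive: if it were near some `z
∈ I`, independence would make it equal to `z`, and `v` would not be alive. -/
theorem MaxIndep.exists_child (hM : MaxIndep n N M) (hIM : I ⊆ M) {v : ℕ}
    (hv : v ∈ alive n N I) : ∃ w ∈ aliveNbrs n N I v, insert w I ⊆ M := by
  obtain ⟨w, hw, hvw⟩ := hM.dominates v (mem_alive.1 hv).1
  refine ⟨w, mem_aliveNbrs.2 ⟨mem_alive.2 ⟨hM.lt w hw, fun z hz h => ?_⟩, hvw⟩,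
    Finset.insert_subset hw hIM⟩
  have := hM.indep w hw z (hIM hz) h
  exact (mem_alive.1 hv).2 z hz (this ▸ hvw)

/-- Each vertex of `M` is near a vertex of `I ⊆ M`, and by independence it is that vertex. -/
theorem MaxIndep.eq_of_alive_empty (hM : MaxIndep n N M) (hIM : I ⊆ M)
    (h : ∀ x, x ∉ alive n N I) : M = I := by
  refine Finset.Subset.antisymm (fun x hx => ?_) hIM
  have := h x
  rw [mem_alive] at this
  push Not at this
  obtain ⟨y, hy, hxy⟩ := this (hM.lt x hx)
  rwa [hM.indep x hx y (hIM hy) hxy]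

/-- The entries of the array from `p` to `q` are characteristic vectors of the sets in the list. -/
def Queue (n : ℕ) (a : ℕ → ℕ) : ℕ → List (Finset ℕ) → ℕ → Prop
  | p, [], q => p = q
  | p, I :: L, q => (∀ x < n, a (p + x) ≠ 0 ↔ x ∈ I) ∧ Queue n a (p + n) L q

theorem Queue.le {a : ℕ → ℕ} {p q : ℕ} {L : List (Finset ℕ)} (h : Queue n a p L q) : p ≤ q := by
  induction L generalizing p with
  | nil => exact (show p = q from h).le
  | cons I L ih => exact (Nat.le_add_right p n).trans (ih h.2)

/-- Used for appending, which writes only from position `q` on. -/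
theorem Queue.congr {a b : ℕ → ℕ} {p q : ℕ} {L : List (Finset ℕ)} (h : Queue n a p L q)
    (hab : ∀ i < q, b i = a i) : Queue n b p L q := by
  induction L generalizing p with
  | nil => exact h
  | cons I L ih =>
    refine ⟨fun x hx => ?_, ih h.2⟩
    rw [hab _ (by have := h.2.le; omega), h.1 x hx]

theorem Queue.append {a : ℕ → ℕ} {p q : ℕ} {L : List (Finset ℕ)} (h : Queue n a p L q)
    (hI : ∀ x < n, a (q + x) ≠ 0 ↔ x ∈ I) : Queue n a p (L ++ [I]) (q + n) := by
  induction L generalizing p with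
  | nil =>
    obtain rfl : p = q := h
    exact ⟨hI, rfl⟩
  | cons J L ih => exact ⟨h.1, ih h.2⟩

end Branching

end CutAlgorithm

/-! ### Blocks for the branching search -/

namespace CutAlgorithm

open RAM RAM.Block

variable {n : ℕ} {N : ℕ → ℕ → Prop} {I : Finset ℕ}

/-- Moves the first set of the queue to array `1`. -/
def readBlock : Block :=
  forN 22 (instr (.load 20 6 23) ⨾ instr (.store 1 22 20) ⨾ instr (.succ 23))

theorem wp_read {Q : State → Prop} {σ : State}
    (hQ : ∀ τ, Frame readBlock σ τ → τ.reg 23 = σ.reg 23 + σ.reg 0 →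
      (∀ x < σ.reg 0, τ.arr 1 x = σ.arr 6 (σ.reg 23 + x)) → Q τ) : wp readBlock Q σ := by
  refine wp_forN (fun k τ => τ.reg 23 = σ.reg 23 + k ∧
    ∀ x < k, τ.arr 1 x = σ.arr 6 (σ.reg 23 + x)) rfl (by simp) ?_ fun τ hF hI => hQ τ hF hI.1 hI.2
  rintro k τ hk hi hF ⟨h1, h2⟩
  have h6 := hF.arr 6 rfl
  simp only [wp_seq, wp_load, wp_store, wp_succ]
  simp only [Nat.forall_lt_succ_right]
  simp [hi, h6, h1, add_assoc]
  intro x hx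
  rw [Function.update_of_ne hx.ne, h2 x hx]

/-- Marks the vertices outside of the closed neighborhood of the set in array `1` in array `7`. -/
def aliveBlock : Block :=
  forN 10 (instr (.const 16 1) ⨾
    forN 11 (nearBlock ⨾ cond (.nonzero 12)
      (instr (.load 20 1 11) ⨾ cond (.nonzero 20) (instr (.const 16 0)) skip) skip) ⨾
    instr (.store 7 10 16))

theorem wp_alive {Q : State → Prop} {σ : State} (hE : Encodes n N σ)
    (hI : ∀ x < n, σ.arr 1 x ≠ 0 ↔ x ∈ I) (hIn : ∀ x ∈ I, x < n)
    (hQ : ∀ τ, Frame aliveBlock σ τ → (∀ x < n, τ.arr 7 x ≠ 0 ↔ x ∈ alive n N I) → Q τ) :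
    wp aliveBlock Q σ := by
  have h0 := hE.1
  refine wp_forN (fun k τ => ∀ x < k, τ.arr 7 x ≠ 0 ↔ x ∈ alive n N I) rfl (by simp) ?_
    fun τ hF h => hQ τ hF (by rwa [h0] at h)
  intro k τ hk hi hF hJ
  rw [h0] at hk
  have hF0 := hF.reg 0 rfl
  have hA1 := hF.arr 1 rfl
  have hEτ := hE.frame hF rfl rfl
  simp only [wp_seq, wp_const]
  refine wp_forN (fun j τ' => τ'.reg 16 ≠ 0 ↔ ∀ y < j, y ∈ I → ¬ N k y) rfl (by simp) ?_ ?_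
  · intro j τ' hj hi' hF' hJ'
    have hG0 := hF'.reg 0 rfl
    have hG10 := hF'.reg 10 rfl
    have hB1 := hF'.arr 1 rfl
    simp [hF0, hA1, hi, h0] at hG0 hG10 hB1 hj
    rw [wp_seq]
    refine wp_near (n := n) (N := N) (Encodes.frame (by simpa [Encodes] using hEτ) hF' rfl rfl)
      (by omega) (by omega) fun τ'' hF'' hN => ?_
    have hH11 := hF''.reg 11 rfl
    have hH16 := hF''.reg 16 rfl
    have hC1 := hF''.arr 1 rfl
    rw [hG10, hi'] at hN
    have hIj := hI j hj
    simp only [wp_cond, wp_seq, wp_load, wp_const, wp_skip, Test.Holds, State.setReg_reg,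
      hH11, hH16, hC1, hB1, hi', hN]
    simp only [Nat.forall_lt_succ_right]
    by_cases h1 : N k j <;> by_cases h2 : j ∈ I
    all_goals
      have h3 := hIj
      simp [h2] at h3
      simp [h1, h2, h3]
      try simpa using hJ'
  · intro τ' hF' hJ'
    have hG10 := hF'.reg 10 rfl
    have hB7 := hF'.arr 7 rfl
    simp [hF0, hi, h0] at hG10 hB7 hJ'
    rw [wp_store]
    simp only [Nat.forall_lt_succ_right]
    simp [hG10, hB7, mem_alive, hk]
    refine ⟨fun x hx => ?_, ?_⟩
    · rw [Function.update_of_ne hx.ne]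
      simpa [mem_alive] using hJ x hx
    · rw [hJ']
      exact ⟨fun h y hy => h y (hIn y hy) hy, fun h y _ hy => h y hy⟩

/-- Register `27` becomes the number of vertices marked in array `7` in the closed neighborhood of
the vertex in register `10`. -/
def degreeBlock : Block :=
  instr (.const 27 0) ⨾
  forN 11 (nearBlock ⨾ cond (.nonzero 12)
    (instr (.load 20 7 11) ⨾ cond (.nonzero 20) (instr (.succ 27)) skip) skip)

theorem wp_degree {Q : State → Prop} {σ : State} (hE : Encodes n N σ)
    (hA : ∀ x < n, σ.arr 7 x ≠ 0 ↔ x ∈ alive n N I) (hv : σ.reg 10 < n)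
    (hQ : ∀ τ, Frame degreeBlock σ τ → τ.reg 27 = (aliveNbrs n N I (σ.reg 10)).card → Q τ) :
    wp degreeBlock Q σ := by
  classical
  refine wp_frame (wp_mono (Q := fun τ => τ.reg 27 = (aliveNbrs n N I (σ.reg 10)).card) ?_
    fun τ hF h _ => hQ τ hF h)
  have h0 := hE.1
  simp only [degreeBlock, wp_seq, wp_const]
  refine wp_forN (fun k τ => τ.reg 27 =
    ((Finset.range k).filter fun x => x ∈ aliveNbrs n N I (σ.reg 10)).card) rfl (by simp) ?_ ?_
  · intro k τ hk hi hF hJ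
    have hF0 := hF.reg 0 rfl
    have hF10 := hF.reg 10 rfl
    have hB7 := hF.arr 7 rfl
    simp [h0] at hF0 hF10 hB7 hk
    rw [wp_seq]
    refine wp_near (n := n) (N := N) (Encodes.frame (by simpa [Encodes] using hE) hF rfl rfl)
      (by omega) (by omega) fun τ' hF' hN => ?_
    have hG11 := hF'.reg 11 rfl
    have hG27 := hF'.reg 27 rfl
    have hC7 := hF'.arr 7 rfl
    rw [hF10, hi] at hN
    have hAk := hA k hk
    simp only [wp_cond, wp_seq, wp_load, wp_succ, wp_skip, Test.Holds, State.setReg_reg,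
      hG11, hG27, hC7, hB7, hi, hN]
    rw [Finset.range_add_one, Finset.filter_insert]
    have hmem := mem_aliveNbrs (n := n) (N := N) (I := I) (v := σ.reg 10) (x := k)
    by_cases h1 : N (σ.reg 10) k <;> by_cases h2 : k ∈ alive n N I
    all_goals
      have h3 := hAk
      simp [h2] at h3
      simp [h1, h2, h3, hJ, hmem]
  · intro τ _ hJ
    simp [h0] at hJ
    rw [hJ]
    congr 1
    ext x
    simp only [Finset.mem_filter, Finset.mem_range, and_iff_right_iff_imp]
    exact fun h => (mem_alive.1 (mem_aliveNbrs.1 h).1).1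

/-- Register `25` becomes an alive vertex with the least number of alive neighbors, or `n` if there
is none. -/
def selectBlock : Block :=
  instr (.copy 25 0) ⨾ instr (.const 26 0) ⨾
  forN 10 (instr (.load 20 7 10) ⨾ cond (.nonzero 20)
    (degreeBlock ⨾ cond (.eq 25 0) (instr (.copy 25 10) ⨾ instr (.copy 26 27))
      (cond (.lt 27 26) (instr (.copy 25 10) ⨾ instr (.copy 26 27)) skip)) skip)

theorem wp_select {Q : State → Prop} {σ : State} (hE : Encodes n N σ)
    (hA : ∀ x < n, σ.arr 7 x ≠ 0 ↔ x ∈ alive n N I)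
    (hQ : ∀ τ, Frame selectBlock σ τ →
      (τ.reg 25 = n ∧ ∀ u, u ∉ alive n N I) ∨ (τ.reg 25 ∈ alive n N I ∧
        ∀ u ∈ alive n N I, (aliveNbrs n N I (τ.reg 25)).card ≤ (aliveNbrs n N I u).card) → Q τ) :
    wp selectBlock Q σ := by
  refine wp_frame (wp_mono (Q := fun τ =>
      (τ.reg 25 = n ∧ ∀ u, u ∉ alive n N I) ∨ (τ.reg 25 ∈ alive n N I ∧
        ∀ u ∈ alive n N I, (aliveNbrs n N I (τ.reg 25)).card ≤ (aliveNbrs n N I u).card)) ?_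
    fun τ hF h _ => hQ τ hF h)
  have h0 := hE.1
  simp only [selectBlock, wp_seq, wp_const, wp_copy]
  refine wp_forN (fun k τ =>
      (τ.reg 25 = n ∧ ∀ u < k, u ∉ alive n N I) ∨ (τ.reg 25 ∈ alive n N I ∧
        τ.reg 26 = (aliveNbrs n N I (τ.reg 25)).card ∧
        ∀ u < k, u ∈ alive n N I →
          (aliveNbrs n N I (τ.reg 25)).card ≤ (aliveNbrs n N I u).card)) rfl (by simp [h0]) ?_ ?_
  · intro k τ hk hi hF hJ
    have hF0 := hF.reg 0 rfl
    have hB7 := hF.arr 7 rfl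
    simp [h0] at hF0 hB7 hk
    have hEτ : Encodes n N τ := Encodes.frame (by simpa [Encodes] using hE) hF rfl rfl
    have hAk := hA k hk
    simp only [wp_seq, wp_load, wp_cond, Test.Holds, State.setReg_reg, hi, hB7, wp_skip]
    simp only [Nat.forall_lt_succ_right]
    norm_num only [if_true, if_false]
    refine ⟨fun h1 => ?_, fun h1 => ?_⟩
    · replace h1 := hAk.1 h1
      refine wp_degree (n := n) (N := N) (I := I) (by simpa [Encodes] using hEτ)
        (by simpa [hB7] using hA) (by simp [hi, hk]) fun τ' hF' h27 => ?_
      have hG0 := hF'.reg 0 rfl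
      have hG10 := hF'.reg 10 rfl
      have hG25 := hF'.reg 25 rfl
      have hG26 := hF'.reg 26 rfl
      simp [hi, hF0] at hG0 hG10 hG25 hG26 h27
      simp only [wp_cond, Test.Holds, wp_seq, wp_copy, wp_skip, State.setReg_reg, hG0, hG10, hG25,
        hG26, h27]
      norm_num only [if_true, if_false]
      refine ⟨fun h3 => ?_, fun h3 => ⟨fun h4 => ?_, fun h4 => ?_⟩⟩
      · rcases hJ with hJ | hJ
        · exact .inr ⟨h1, trivial, fun u hu hu1 => absurd hu1 (hJ.2 u hu), fun _ => le_rfl⟩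
        · exact absurd h3 (mem_alive.1 hJ.1).1.ne
      · rcases hJ with hJ | hJ
        · exact absurd hJ.1 h3
        · rw [hJ.2.1] at h4
          exact .inr ⟨h1, trivial, fun u hu hu1 => h4.le.trans (hJ.2.2 u hu hu1), fun _ => le_rfl⟩
      · rcases hJ with hJ | hJ
        · exact absurd hJ.1 h3
        · rw [hJ.2.1] at h4
          exact .inr ⟨hJ.1, hJ.2.1, hJ.2.2, fun _ => not_lt.1 h4⟩
    · replace h1 : k ∉ alive n N I := fun h => h1 (hAk.2 h)
      exact hJ.imp (fun h => ⟨h.1, h.2, h1⟩)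
        fun h => ⟨h.1, h.2.1, h.2.2, fun h3 => absurd h3 h1⟩
  · intro τ _ h
    simp [h0] at h
    exact h.imp (fun h => ⟨h.1, fun u hu => h.2 u (mem_alive.1 hu).1 hu⟩)
      fun h => ⟨h.1, fun u hu => h.2.2 u (mem_alive.1 hu).1 hu⟩

/-- Appends the set in array `1` together with the vertex in register `22` to the queue. -/
def appendBlock : Block :=
  forN 21 (instr (.load 20 1 21) ⨾ cond (.eq 21 22) (instr (.const 20 1)) skip ⨾
    instr (.store 6 24 20) ⨾ instr (.succ 24))

theorem wp_append {Q : State → Prop} {σ : State} (h0 : σ.reg 0 = n)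
    (hI : ∀ x < n, σ.arr 1 x ≠ 0 ↔ x ∈ I)
    (hQ : ∀ τ, Frame appendBlock σ τ → τ.reg 24 = σ.reg 24 + n →
      (∀ i < σ.reg 24, τ.arr 6 i = σ.arr 6 i) →
      (∀ x < n, τ.arr 6 (σ.reg 24 + x) ≠ 0 ↔ x ∈ insert (σ.reg 22) I) → Q τ) :
    wp appendBlock Q σ := by
  refine wp_forN (fun k τ => τ.reg 24 = σ.reg 24 + k ∧ (∀ i < σ.reg 24, τ.arr 6 i = σ.arr 6 i) ∧
      ∀ x < k, τ.arr 6 (σ.reg 24 + x) ≠ 0 ↔ x ∈ insert (σ.reg 22) I) rfl (by simp) ?_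
    fun τ hF h => hQ τ hF (h0 ▸ h.1) h.2.1 (by rw [← h0]; exact h.2.2)
  rintro k τ hk hi hF ⟨h1, h2, h3⟩
  rw [h0] at hk
  have hF22 := hF.reg 22 rfl
  have hA1 := hF.arr 1 rfl
  have hIk := hI k hk
  have h2' (a : ℕ) (i) (hi : i < σ.reg 24) :
      Function.update (τ.arr 6) (σ.reg 24 + k) a i = σ.arr 6 i := by
    rw [Function.update_of_ne (by omega), h2 i hi]
  have h3' (a : ℕ) (x) (hx : x < k) :
      ¬ Function.update (τ.arr 6) (σ.reg 24 + k) a (σ.reg 24 + x) = 0 ↔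
        x = σ.reg 22 ∨ x ∈ I := by
    rw [Function.update_of_ne (by omega), ← ne_eq, h3 x hx, Finset.mem_insert]
  simp only [wp_seq, wp_load, wp_cond, wp_const, wp_skip, wp_store, wp_succ, Test.Holds]
  simp only [Nat.forall_lt_succ_right]
  simp [hi, hA1, h1, hF22, add_assoc]
  refine ⟨fun h => ⟨h2' _, h3' _, .inl h⟩, fun h => ⟨h2' _, h3' _, ?_⟩⟩
  simpa [h] using hIk

/-- Appends the children of the set in array `1` to the queue. -/
def branchBlock : Block :=
  forN 22 (instr (.copy 10 25) ⨾ instr (.copy 11 22) ⨾ nearBlock ⨾ cond (.nonzero 12)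
    (instr (.load 20 7 22) ⨾ cond (.nonzero 20) appendBlock skip) skip)

theorem wp_branch {Q : State → Prop} {σ : State} (hE : Encodes n N σ)
    (hI : ∀ x < n, σ.arr 1 x ≠ 0 ↔ x ∈ I) (hA : ∀ x < n, σ.arr 7 x ≠ 0 ↔ x ∈ alive n N I)
    (hv : σ.reg 25 < n) {L : List (Finset ℕ)} {p : ℕ} (hL : Queue n (σ.arr 6) p L (σ.reg 24))
    (hQ : ∀ τ, Frame branchBlock σ τ →
      Queue n (τ.arr 6) p (L ++ children n N I (σ.reg 25) n) (τ.reg 24) → Q τ) :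
    wp branchBlock Q σ := by
  have h0 := hE.1
  refine wp_forN (fun k τ => Queue n (τ.arr 6) p (L ++ children n N I (σ.reg 25) k) (τ.reg 24)) rfl
    (by simpa [children] using hL) ?_ fun τ hF h => hQ τ hF (by rwa [h0] at h)
  intro k τ hk hi hF hJ
  rw [h0] at hk
  have hF0 := hF.reg 0 rfl
  have hF25 := hF.reg 25 rfl
  have hA1 := hF.arr 1 rfl
  have hA7 := hF.arr 7 rfl
  have hEτ := hE.frame hF rfl rfl
  simp only [wp_seq, wp_copy]
  refine wp_near (n := n) (N := N) (by simpa [Encodes] using hEτ) (by simp [hF25, hv])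
    (by simp [hi, hk]) fun τ' hF' hN => ?_
  have hG0 := hF'.reg 0 rfl
  have hG22 := hF'.reg 22 rfl
  have hG24 := hF'.reg 24 rfl
  have hB1 := hF'.arr 1 rfl
  have hB6 := hF'.arr 6 rfl
  have hB7 := hF'.arr 7 rfl
  simp [hF25, hi, hF0, h0, hA1, hA7] at hN hG0 hG22 hG24 hB1 hB6 hB7
  have hAk := hA k hk
  rw [children_succ]
  simp only [wp_cond, wp_seq, wp_load, wp_skip, Test.Holds, State.setReg_reg, hG22, hB7]
  norm_num only [if_true, if_false]
  refine ⟨fun h1 => ⟨fun h2 => ?_, fun h2 => ?_⟩, fun h1 => ?_⟩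
  · rw [if_pos (mem_aliveNbrs.2 ⟨hAk.1 h2, hN.1 h1⟩), ← List.append_assoc]
    refine wp_append (n := n) (I := I) (by simp [hG0]) (by simpa [hB1] using hI)
      fun τ'' hF'' h24 hlt hins => ?_
    simp [hG24, hB6, hG22] at h24 hlt hins
    rw [State.setReg_arr, h24]
    exact (hJ.congr hlt).append (by simpa using hins)
  · rw [if_neg fun h => h2 (hAk.2 (mem_aliveNbrs.1 h).1)]
    simpa [hB6, hG24] using hJ
  · rw [if_neg fun h => h1 (hN.2 (mem_aliveNbrs.1 h).2)]
    simpa [hB6, hG24] using hJ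

end CutAlgorithm

/-! ### Correctness and running time of the search -/

namespace CutAlgorithm

open RAM RAM.Block

variable {n : ℕ} {G : SimpleGraph (Fin n)}

theorem closedNbr_refl (G : SimpleGraph (Fin n)) : ∀ x < n, closedNbr G x x :=
  fun x hx => ⟨⟨x, hx⟩, ⟨x, hx⟩, .inl rfl, rfl, rfl⟩

theorem closedNbr_symm (G : SimpleGraph (Fin n)) : ∀ x y, closedNbr G x y → closedNbr G y x := by
  rintro _ _ ⟨i, j, h, rfl, rfl⟩
  exact ⟨j, i, h.imp Eq.symm SimpleGraph.Adj.symm, rfl, rfl⟩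

theorem Indep.isIndepSet {I : Finset ℕ} (hI : Indep (closedNbr G) I) :
    G.IsIndepSet {j : Fin n | j.val ∈ I} := by
  intro i hi j hj hne hadj
  exact hne (Fin.ext (hI i hi j hj (closedNbr_coe.2 (.inr hadj))))

/-- `b` is the size of the independent cutset with characteristic vector `a`, or `n` if no
independent cutset has been found. -/
def Solution (G : SimpleGraph (Fin n)) (b : ℕ) (a : ℕ → ℕ) : Prop :=
  b = n ∨ ∃ F : Finset (Fin n), G.IsIndepCutset F ∧ F.card = b ∧
    ∀ i : Fin n, a i = if i ∈ F then 1 else 0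

/-- The invariant of the search for a minimum independent cutset: all maximal independent sets that
contain none of the sets in the queue `L` have been treated. -/
structure SearchInvariant (G : SimpleGraph (Fin n)) (L : List (Finset ℕ)) (σ : State) : Prop where
  encodes : Encodes n (closedNbr G) σ
  zero : ∀ l ≥ n, σ.arr 4 l = 0
  le : σ.reg 1 ≤ n
  solution : Solution G (σ.reg 1) (σ.arr 2)
  queue : Queue n (σ.arr 6) (σ.reg 23) L (σ.reg 24)
  lt : ∀ I ∈ L, ∀ x ∈ I, x < n
  indep : ∀ I ∈ L, Indep (closedNbr G) I
  cover : ∀ M, MaxIndep n (closedNbr G) M → (∃ I ∈ L, I ⊆ M) ∨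
    ∀ X, Nontrivial n (fun x => x ∈ M) X → σ.reg 1 ≤ cutWeight n (closedNbr G) (fun x => x ∈ M) X

/-- One step of the search for a minimum independent cutset. -/
def searchBlock : Block :=
  readBlock ⨾ aliveBlock ⨾ selectBlock ⨾ cond (.lt 25 0) branchBlock minCutBlock

/-- If a vertex is alive, the first set is replaced by its children, one of which still lies in any
given maximal independent set containing it. If none is alive, the first set is the only maximal
independent set containing it, and the cut algorithm treats it. -/
theorem wp_searchBlock {I : Finset ℕ} {L : List (Finset ℕ)} {σ : State}
    (h : SearchInvariant G (I :: L) σ) :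
    wp searchBlock (fun τ => ∃ L', SearchInvariant G L' τ ∧
      totalPotential n (closedNbr G) L' ≤ totalPotential n (closedNbr G) (I :: L) - 1) σ := by
  classical
  have h0 := h.encodes.1
  have hIn := h.lt I List.mem_cons_self
  have hIi := h.indep I List.mem_cons_self
  simp only [searchBlock, wp_seq]
  refine wp_read fun τ₁ hF₁ h23 hread => ?_
  have hE₁ := h.encodes.frame hF₁ rfl rfl
  rw [h0] at h23 hread
  have hI₁ : ∀ x < n, τ₁.arr 1 x ≠ 0 ↔ x ∈ I := fun x hx => by
    rw [hread x hx, h.queue.1 x hx]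
  rw [wp_seq]
  refine wp_alive hE₁ hI₁ hIn fun τ₂ hF₂ hA₂ => ?_
  have hE₂ := hE₁.frame hF₂ rfl rfl
  rw [wp_seq]
  refine wp_select hE₂ hA₂ fun τ₃ hF₃ hS => ?_
  have hE₃ := hE₂.frame hF₃ rfl rfl
  have h1 : τ₃.reg 1 = σ.reg 1 := by rw [hF₃.reg 1 rfl, hF₂.reg 1 rfl, hF₁.reg 1 rfl]
  have h23' : τ₃.reg 23 = σ.reg 23 + n := by rw [hF₃.reg 23 rfl, hF₂.reg 23 rfl, h23]
  have h24 : τ₃.reg 24 = σ.reg 24 := by rw [hF₃.reg 24 rfl, hF₂.reg 24 rfl, hF₁.reg 24 rfl]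
  have a1 : τ₃.arr 1 = τ₁.arr 1 := by rw [hF₃.arr 1 rfl, hF₂.arr 1 rfl]
  have a2 : τ₃.arr 2 = σ.arr 2 := by rw [hF₃.arr 2 rfl, hF₂.arr 2 rfl, hF₁.arr 2 rfl]
  have a4 : τ₃.arr 4 = σ.arr 4 := by rw [hF₃.arr 4 rfl, hF₂.arr 4 rfl, hF₁.arr 4 rfl]
  have a6 : τ₃.arr 6 = σ.arr 6 := by rw [hF₃.arr 6 rfl, hF₂.arr 6 rfl, hF₁.arr 6 rfl]
  have a7 : τ₃.arr 7 = τ₂.arr 7 := hF₃.arr 7 rfl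
  have hI₃ : ∀ x < n, τ₃.arr 1 x ≠ 0 ↔ x ∈ I := by rwa [a1]
  have hA₃ : ∀ x < n, τ₃.arr 7 x ≠ 0 ↔ x ∈ alive n (closedNbr G) I := by rwa [a7]
  have hL₃ : Queue n (τ₃.arr 6) (τ₃.reg 23) L (τ₃.reg 24) := by
    rw [a6, h23', h24]
    exact h.queue.2
  rw [wp_cond]
  simp only [Test.Holds, hE₃.1]
  refine ⟨fun hlt => ?_, fun hge => ?_⟩
  · obtain ⟨hv, hmin⟩ := hS.resolve_left fun h => hlt.ne h.1
    refine wp_branch hE₃ hI₃ hA₃ hlt hL₃ fun τ hF hQ => ?_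
    have b1 : τ.reg 1 = σ.reg 1 := by rw [hF.reg 1 rfl, h1]
    refine ⟨L ++ children n (closedNbr G) I (τ₃.reg 25) n,
      ⟨hE₃.frame hF rfl rfl, ?_, b1.trans_le h.le, ?_, ?_, ?_, ?_, fun M hM => ?_⟩, ?_⟩
    · rw [hF.arr 4 rfl, a4]
      exact h.zero
    · rw [b1, hF.arr 2 rfl, a2]
      exact h.solution
    · rw [hF.reg 23 rfl]
      exact hQ
    · intro J hJ
      rcases List.mem_append.1 hJ with hJ | hJ
      · exact h.lt J (List.mem_cons_of_mem _ hJ)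
      · obtain ⟨w, hw, rfl⟩ := mem_children.1 hJ
        intro x hx
        rcases Finset.mem_insert.1 hx with rfl | hx
        · exact (mem_alive.1 (mem_aliveNbrs.1 hw).1).1
        · exact hIn x hx
    · intro J hJ
      rcases List.mem_append.1 hJ with hJ | hJ
      · exact h.indep J (List.mem_cons_of_mem _ hJ)
      · obtain ⟨w, hw, rfl⟩ := mem_children.1 hJ
        exact hIi.insert (closedNbr_symm G) (mem_aliveNbrs.1 hw).1
    · rw [b1]
      refine (h.cover M hM).imp_left ?_
      rintro ⟨J, hJ, hJM⟩
      rcases List.mem_cons.1 hJ with rfl | hJ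
      · obtain ⟨w, hw, hwM⟩ := hM.exists_child hJM hv
        exact ⟨_, List.mem_append_right _ (mem_children.2 ⟨w, hw, rfl⟩), hwM⟩
      · exact ⟨J, List.mem_append_left _ hJ, hJM⟩
    · have := totalPotential_children_le (closedNbr_refl G) (closedNbr_symm G) hv hmin
      simp only [totalPotential, List.map_append, List.sum_append, List.map_cons,
        List.sum_cons] at this ⊢
      linarith
  · have hempty : ∀ x, x ∉ alive n (closedNbr G) I :=
      (hS.resolve_right fun h => hge (mem_alive.1 h.1).1).2
    refine wp_minCut (T := fun x => x ∈ I) (V := Solution G) hE₃ (by rw [a4]; exact h.zero) hI₃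
      (by rw [h1, a2]; exact h.solution) ?_ ?_
    · intro X a hX hlt ha
      obtain ⟨-, hF, hcard⟩ := cutFinset_spec hIi.isIndepSet hX
        (hlt.trans_le (h1.trans_le h.le))
      refine .inr ⟨_, hF, hcard, fun i => ?_⟩
      rw [ha i i.2, if_congr mem_cutFinset rfl rfl]
    · intro τ hF hz hle hV hmin
      rw [h1] at hle
      refine ⟨L, ⟨hE₃.frame hF rfl rfl, hz, hle.trans h.le, hV, ?_,
        fun J hJ => h.lt J (List.mem_cons_of_mem _ hJ),
        fun J hJ => h.indep J (List.mem_cons_of_mem _ hJ), fun M hM => ?_⟩, ?_⟩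
      · rw [hF.arr 6 rfl, hF.reg 23 rfl, hF.reg 24 rfl]
        exact hL₃
      · rcases h.cover M hM with ⟨J, hJ, hJM⟩ | hc
        · rcases List.mem_cons.1 hJ with rfl | hJ
          · obtain rfl := hM.eq_of_alive_empty hJM hempty
            exact .inr hmin
          · exact .inl ⟨J, hJ, hJM⟩
        · exact .inr fun X hX => hle.trans (hc X hX)
      · have h3 : (1 : ℝ) ≤ potential (alive n (closedNbr G) I).card := by
          refine le_trans ?_ (potential_mono (Nat.zero_le _))
          simp [potential]
        simp only [totalPotential, List.map_cons, List.sum_cons]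
        linarith

/-- Extend the cutset to a maximal independent set `M`. With an empty queue `M` has been treated, so
the best solution is at most the weight of any cut for `M`, in particular of the one obtained from
the cutset. -/
theorem SearchInvariant.le_card (hG : G.Connected) {σ : State} (h : SearchInvariant G [] σ)
    {S : Finset (Fin n)} (hS : G.IsIndepCutset S) : σ.reg 1 ≤ S.card := by
  have hI : Indep (closedNbr G) (S.map Fin.valEmbedding) := by
    intro x hx y hy hxy
    obtain ⟨i, hi, rfl⟩ := Finset.mem_map.1 hx
    obtain ⟨j, hj, rfl⟩ := Finset.mem_map.1 hy
    rcases closedNbr_coe.1 hxy with rfl | hadj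
    · rfl
    · exact absurd hadj (hS.1 hi hj hadj.ne)
  obtain ⟨M, hSM, hM⟩ := exists_maxIndep (closedNbr_refl G) (closedNbr_symm G)
    (by simp) hI
  obtain ⟨X, hX, hle⟩ := exists_cutWeight_le (T := fun x => x ∈ M) hG hM.indep.isIndepSet
    (fun i hi => hSM (Finset.mem_map_of_mem _ hi)) hS.2
  refine ((h.cover M hM).resolve_left ?_ X hX).trans hle
  rintro ⟨I, hI, -⟩
  exact absurd hI List.not_mem_nil

/-- Initially, the queue consists of the empty set. -/
def initBlock : Block := instr (.copy 1 0) ⨾ instr (.copy 24 0)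

theorem wp_initBlock (G : SimpleGraph (Fin n)) :
    wp initBlock (SearchInvariant G [∅]) (graphInput G) := by
  simp only [initBlock, wp_seq, wp_copy]
  refine ⟨encodes_of_graphArray ?_ ?_, ?_, ?_, .inl ?_, ?_, ?_, ?_, fun M _ => .inl ⟨∅, ?_, ?_⟩⟩
  · simp [graphInput]
  · simp [graphInput]
  · simp [graphInput]
  · simp [graphInput]
  · simp [graphInput]
  · simp [graphInput, Queue]
  · simp
  · simp [Indep]
  · simp
  · simp

theorem eval_natCast_le (p : Polynomial ℕ) {n : ℕ} (hn : 1 ≤ n) :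
    p.eval n ≤ p.eval 1 * n ^ p.natDegree := by
  rw [Polynomial.eval_eq_sum_range, Polynomial.eval_eq_sum_range, Finset.sum_mul]
  refine Finset.sum_le_sum fun i hi => ?_
  rw [one_pow, mul_one]
  exact Nat.mul_le_mul_left _
    (Nat.pow_le_pow_right hn (Nat.lt_succ_iff.1 (Finset.mem_range.1 hi)))

theorem isOStar_search (p q : Polynomial ℕ) :
    IsOStar (fun n => p.eval n + (1 + ⌊potential n⌋₊ * (q.eval n + 1)))
      fun n => (3 : ℝ) ^ ((n : ℝ) / 3) := by
  -- The additional power of `n` absorbs the factor `n + 1 ≤ 2 * n` of the potential, and `p(1)`,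
  -- `q(1)` are the sums of the coefficients.
  refine ⟨p.natDegree + q.natDegree + 1, .of_bound (p.eval 1 + 1 + 2 * (q.eval 1 + 1) : ℕ) ?_⟩
  filter_upwards [eventually_ge_atTop 1] with n hn
  set i := p.natDegree
  set j := q.natDegree
  set e : ℝ := (3 : ℝ) ^ ((n : ℝ) / 3) with he
  have hn' : (1 : ℝ) ≤ n := by exact_mod_cast hn
  have he1 : 1 ≤ e := Real.one_le_rpow (by norm_num) (by positivity)
  have hp : ((p.eval n : ℕ) : ℝ) ≤ (p.eval 1 : ℕ) * (n : ℝ) ^ (i + j + 1) := by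
    calc ((p.eval n : ℕ) : ℝ) ≤ (p.eval 1 : ℕ) * (n : ℝ) ^ i := by
          exact_mod_cast eval_natCast_le p hn
      _ ≤ _ := by gcongr; omega
  have hq : ((q.eval n : ℕ) : ℝ) + 1 ≤ ((q.eval 1 : ℕ) + 1) * (n : ℝ) ^ j := by
    have h1 : ((q.eval n : ℕ) : ℝ) ≤ (q.eval 1 : ℕ) * (n : ℝ) ^ j := by
      exact_mod_cast eval_natCast_le q hn
    have h2 : (1 : ℝ) ≤ (n : ℝ) ^ j := one_le_pow₀ hn'
    linarith
  have hpot : (⌊potential n⌋₊ : ℝ) ≤ 2 * n * e := by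
    refine (Nat.floor_le (potential_nonneg n)).trans ?_
    unfold potential
    rw [← he]
    gcongr
    linarith
  have h1 : (1 : ℝ) ≤ (n : ℝ) ^ (i + j + 1) := one_le_pow₀ hn'
  rw [Real.norm_of_nonneg (by positivity), Real.norm_of_nonneg (by positivity)]
  push_cast
  set a : ℝ := ((p.eval 1 : ℕ) : ℝ)
  set b : ℝ := ((q.eval 1 : ℕ) : ℝ)
  have ha : 0 ≤ a := Nat.cast_nonneg _
  have hb : 0 ≤ b := Nat.cast_nonneg _
  have h2 : a * (n : ℝ) ^ (i + j + 1) ≤ a * ((n : ℝ) ^ (i + j + 1) * e) := by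
    gcongr
    exact le_mul_of_one_le_right (by positivity) he1
  have h3 : (1 : ℝ) ≤ (n : ℝ) ^ (i + j + 1) * e := one_le_mul_of_one_le_of_one_le h1 he1
  have h4 : (⌊potential n⌋₊ : ℝ) * (((q.eval n : ℕ) : ℝ) + 1) ≤
      2 * (b + 1) * ((n : ℝ) ^ (i + j + 1) * e) := by
    calc (⌊potential n⌋₊ : ℝ) * (((q.eval n : ℕ) : ℝ) + 1)
        ≤ (2 * n * e) * ((b + 1) * (n : ℝ) ^ j) := by gcongr
      _ = 2 * (b + 1) * ((n : ℝ) ^ (j + 1) * e) := by ring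
      _ ≤ _ := by gcongr; omega
  linarith

theorem exists_program_minimum :
    ∃ (P : RAM.Program) (T : ℕ → ℕ), IsOStar T (fun n => (3 : ℝ) ^ ((n : ℝ) / 3)) ∧
      ∀ (n : ℕ) (G : SimpleGraph (Fin n)), G.Connected →
        (∃ S : Finset (Fin n), G.IsIndepCutset S) →
        RAM.HaltsWithin P (RAM.graphInput G) (T n) fun σ =>
          ∃ S : Finset (Fin n), RAM.Outputs σ S ∧ G.IsMinimumIndepCutset S := by
  refine ⟨.seq initBlock.compile (.loop (.lt 23 24) searchBlock.compile), _,
    isOStar_search initBlock.cost searchBlock.cost, fun n G hG ⟨S, hS⟩ => ?_⟩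
  have hinit : SearchInvariant G [∅] (initBlock.run (graphInput G)) := wp_initBlock G
  obtain ⟨s, hs, es⟩ := initBlock.exec_compile (by decide) (by decide) (graphInput G)
  have hpot : totalPotential n (closedNbr G) [∅] = potential n := by
    simp [totalPotential, alive]
  have hloop := haltsWithin_loop (b := .lt 23 24) (p := searchBlock) (by decide) (by decide)
    (n := n) (fun x σ => ∃ L, SearchInvariant G L σ ∧ totalPotential n (closedNbr G) L = x)
    (fun x σ hx => ?_) (fun x σ hx hb => ?_) ⟨_, hinit, hpot⟩
  · obtain ⟨t, ht, τ, et, ⟨x, L, hL, -⟩, hτ⟩ := hloop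
    have h0 : (graphInput G).reg 0 = n := by simp [graphInput]
    rw [h0] at hs
    refine ⟨s + t, add_le_add hs ht, τ, .seq es et, ?_⟩
    obtain rfl : L = [] := by
      cases L with
      | nil => rfl
      | cons I L =>
        have := hL.queue.2.le
        -- For `n = 0` the sets would occupy no cells, and a nonempty queue would look empty.
        have : n ≠ 0 := by
          rintro rfl
          exact hG.nonempty.elim Fin.elim0
        exact absurd (show τ.reg 23 < τ.reg 24 by omega) hτ
    rcases hL.solution with hn | ⟨F, hF, hcard, hout⟩
    · have := hL.le_card hG hS
      have := card_lt_of_isCutset hS.2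
      omega
    · exact ⟨F, hout, hF, fun R hR => hcard.trans_le (hL.le_card hG hR)⟩
  · obtain ⟨L, hL, rfl⟩ := hx
    refine ⟨hL.encodes.1, List.sum_nonneg ?_⟩
    simp only [List.mem_map]
    rintro _ ⟨I, -, rfl⟩
    exact potential_nonneg _
  · obtain ⟨L, hL, rfl⟩ := hx
    cases L with
    | nil => exact absurd hb (show σ.reg 23 = σ.reg 24 from hL.queue).not_lt
    | cons I L =>
      refine wp_mono (wp_searchBlock hL) fun τ _ h => ?_
      obtain ⟨L', hL', hle⟩ := h
      exact ⟨_, hle, L', hL', rfl⟩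

end CutAlgorithm

theorem mainTheorem3 :
    -- a minimum independent cutset can be found in time `O*(3^(n/3))`
    (∃ (P : RAM.Program) (T : ℕ → ℕ), IsOStar T (fun n => (3 : ℝ) ^ ((n : ℝ) / 3)) ∧
      ∀ (n : ℕ) (G : SimpleGraph (Fin n)), G.Connected →
        (∃ S : Finset (Fin n), G.IsIndepCutset S) →
        RAM.HaltsWithin P (RAM.graphInput G) (T n) fun σ =>
          ∃ S : Finset (Fin n), RAM.Outputs σ S ∧ G.IsMinimumIndepCutset S) ∧
    -- a smallest independent cutset inside a given one can be found in polynomial time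
    (∃ (P : RAM.Program) (p : Polynomial ℕ),
      ∀ (n : ℕ) (G : SimpleGraph (Fin n)), G.Connected →
        ∀ S' : Finset (Fin n), G.IsIndepCutset S' →
        RAM.HaltsWithin P (RAM.graphSetInput G S') (p.eval n) fun σ =>
          ∃ S : Finset (Fin n), RAM.Outputs σ S ∧ G.IsSmallestIndepCutsetIn S' S) ∧
    -- these are the minimum edge cuts of the auxiliary hypergraph
    (∀ (n : ℕ) (G : SimpleGraph (Fin n)), G.Connected →
      ∀ S' : Finset (Fin n), G.IsIndepCutset S' →
        ∀ F : Finset {v // v ∈ S'},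
          (G.cutHypergraph S').IsMinimumEdgeCut F ↔
            G.IsSmallestIndepCutsetIn S' (F.map (Function.Embedding.subtype _))) :=
  ⟨CutAlgorithm.exists_program_minimum, CutAlgorithm.exists_program_smallest,
    fun _ _ hG _ hS' F => SimpleGraph.isMinimumEdgeCut_iff hG hS'.1 F⟩
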